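/- \textbf{Theorem.} There exist absolute constants $C, c > 0$ with the following property. Let $n \ge 1$ and let $\mathbf X = \{X_{i,j} : 1 \le i,j \le n\}$ be an $n\times n$ array of independent real random variables with means $a_{i,j} = \mathbb E X_{i,j}$ and variances $c_{i,j}^2 = \operatorname{Var}(X_{i,j})$, such that $$\sum_{i=1}^n a_{i,j} = 0 \ \text{ for all } 1\le j\le n, \qquad \sum_{j=1}^n a_{i,j} = 0 \ \text{ for all } 1 \le i\le n,$$ and $$\frac{1}{n-1}\sum_{i=1}^n\sum_{j=1}^n a_{i,j}^2 + \frac1n \sum_{i=1}^n\sum_{j=1}^n c_{i,j}^2 = 1$$ (for $n=1$, where $a_{1,1}=0$, the first term is read as $0$). Let $\pi$ be a uniformly distributed random permutation of $\{1,\dots,n\}$, independent of $\mathbf X$, and let $W = \sum_{i=1}^n X_{i,\pi(i)}$. Let $\alpha_n \ge 1$ and $b \ge 1$ be real numbers such that $$\max_{1\le i,j\le n} \mathbb E \exp(\alpha_n |X_{i,j}|) \le b .$$ Put $\theta_n = n^{1/2}\alpha_n^{-1}$ and $\delta_n = b^2(\alpha_n^{-1} + n^{-1/2})(\theta_n^{-2}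 + \theta_n^6)$, and let $\Phi$ be the standard normal distribution function. Then $$\left| \frac{\mathbb P(W > z)}{1-\Phi(z)} - 1 \right| \le C\,\delta_n\,(1+z^3)$$ for all $z$ with $0 \le z \le c\,\alpha_n^{1/3} \min\{1,\ b^{-1}(\theta_n^{-1/2} + \theta_n)^{-1}\}$. -/

import Mathlib

open MeasureTheory ProbabilityTheory

/-- The finite set of permutations of `Fin n` carries the discrete σ-algebra. -/
instance permMeasurableSpace (n : ℕ) : MeasurableSpace (Equiv.Perm (Fin n)) := ⊤

noncomputable section

/-- The standard normal distribution function `Φ`. -/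
def stdNormalCDF (z : ℝ) : ℝ := cdf (gaussianReal 0 1) z

/-- `W = ∑ i, X i (π i)`, for a random array `X` and a random permutation `π`. -/
def permSum {Ω : Type*} {n : ℕ} (X : Fin n → Fin n → Ω → ℝ)
    (π : Ω → Equiv.Perm (Fin n)) (ω : Ω) : ℝ :=
  ∑ i, X i (π ω i) ω

/-- `θₙ = n^{1/2} αₙ⁻¹`. -/
def thetaN (n : ℕ) (α : ℝ) : ℝ := (n : ℝ) ^ (1 / 2 : ℝ) * α⁻¹

/-- `δₙ = b² (αₙ⁻¹ + n^{-1/2}) (θₙ⁻² + θₙ⁶)`. -/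
def deltaN (n : ℕ) (α b : ℝ) : ℝ :=
  b ^ 2 * (α⁻¹ + (n : ℝ) ^ (-(1 / 2) : ℝ)) * (thetaN n α ^ (-2 : ℤ) + thetaN n α ^ 6)

end

/-! The proof is analytic. Conditioning on `π` shows that the complex moment generating function of
W is 1/n! times the permanent of the matrix of the entries' moment generating functions
(`IsPermutedArray.complexMGF_permSum`). For |s| below R = α / (20 (1 + log b)) every entry of that
matrix lies within 1/15 of 1 (`norm_complexMGF_sub_one_le`), and such permanents do not vanish
(`permanent_near_ones`, an induction in the manner of Barvinok). Hence the generating function Ψ has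
a holomorphic logarithm f on a disc of radius R.

Since |Ψ| ≤ e^n there, Borel–Carathéodory and Cauchy's estimate bound f''' by a multiple of n / R³
on a smaller disc. The centering and the normalization give f'(0) = 0 and f''(0) = 1, so f' differs
from s by at most κ|s|² with κ = 768 n / R³ (`exists_log_near_gaussian`). As n = θ²α², κ is of order
θ² α⁻¹ (1 + log b)³, which is O(δ).

What remains is Cramér's method (`exists_moderate_deviation_of_isLogMGF`). Under the tilt by e^{zW},
the law of W - z has a nearly Gaussian characteristic function on a long interval. Esseen smoothing
(`exists_interval_prob_near_gaussian`) converts this into closeness of interval probabilities.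
Undoing the tilt expresses both P(W > z) and 1 - Φ(z) as prefactors times integrals of e^{-zy} over
y > 0, and the Mills ratio bound makes the error relative. -/

/-! ### Permanents near the all-ones matrix -/

open Equiv in
theorem Matrix.permanent_succ_row_zero {R : Type*} [CommSemiring R] {n : ℕ}
    (A : Matrix (Fin (n + 1)) (Fin (n + 1)) R) :
    A.permanent = ∑ j, A 0 j *
      (Matrix.of fun i l : Fin n => A i.succ (Equiv.swap 0 j l.succ)).permanent := by
  rw [← Matrix.permanent_transpose, Matrix.permanent,
    ← Equiv.sum_comp Perm.decomposeFin.symm, Fintype.sum_prod_type]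
  refine Finset.sum_congr rfl fun j _ => ?_
  rw [← Matrix.permanent_transpose, Matrix.permanent, Finset.mul_sum]
  refine Finset.sum_congr rfl fun σ _ => ?_
  rw [Fin.prod_univ_succ]
  simp [Matrix.transpose_apply]

/-- The matrices whose entries lie within `1/15` of `1`. -/
def NearOnes {n : ℕ} (A : Matrix (Fin n) (Fin n) ℂ) : Prop := ∀ i j, ‖A i j - 1‖ ≤ 1 / 15

/-- With N terms, changing the coefficients moves the sum by at most N·(2/15)(3/2)‖w‖ = N‖w‖/5,
while the sum stays within N(1/10 + 1/2)‖w‖ of Nw and so has norm at least 2N‖w‖/5. The ratio is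
again 1/2, so the estimate reproduces itself in an induction; 1/15 is the largest radius for which
this arithmetic closes. -/
theorem norm_sum_mul_perturb {ι : Type*} [Fintype ι] (a b u : ι → ℂ) (w : ℂ)
    (hw : w ≠ 0) [Nonempty ι] (ha : ∀ i, ‖a i - 1‖ ≤ 1 / 15) (hb : ∀ i, ‖b i - 1‖ ≤ 1 / 15)
    (hu : ∀ i, ‖u i - w‖ ≤ 1 / 2 * ‖w‖) :
    ∑ i, b i * u i ≠ 0 ∧
      ‖∑ i, a i * u i - ∑ i, b i * u i‖ ≤ 1 / 2 * ‖∑ i, b i * u i‖ := by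
  have hw0 : 0 < ‖w‖ := norm_pos_iff.2 hw
  have hN : (0 : ℝ) < Fintype.card ι := by exact_mod_cast Fintype.card_pos
  have hun : ∀ i, ‖u i‖ ≤ 3 / 2 * ‖w‖ := fun i => by
    have : ‖u i‖ ≤ ‖u i - w‖ + ‖w‖ := by simpa using norm_add_le (u i - w) w
    linarith [hu i]
  have h1 : ‖∑ i, a i * u i - ∑ i, b i * u i‖ ≤ Fintype.card ι * (1 / 5 * ‖w‖) := by
    rw [← Finset.sum_sub_distrib]
    refine (norm_sum_le _ _).trans ?_
    refine (Finset.sum_le_card_nsmul _ _ (1 / 5 * ‖w‖) fun i _ => ?_).trans (by simp)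
    rw [← sub_mul, norm_mul]
    have : ‖a i - b i‖ ≤ 2 / 15 := by
      have := norm_sub_le (a i - 1) (b i - 1)
      rw [sub_sub_sub_cancel_right] at this
      linarith [ha i, hb i]
    nlinarith [hun i, norm_nonneg (a i - b i), norm_nonneg (u i)]
  have h2 : ‖∑ i, b i * u i - Fintype.card ι * w‖ ≤ Fintype.card ι * (3 / 5 * ‖w‖) := by
    have : ∑ i, b i * u i - Fintype.card ι * w = ∑ i, (b i * u i - w) := by simp
    rw [this]
    refine (norm_sum_le _ _).trans ?_
    refine (Finset.sum_le_card_nsmul _ _ (3 / 5 * ‖w‖) fun i _ => ?_).trans (by simp)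
    have : b i * u i - w = (b i - 1) * u i + (u i - w) := by ring
    rw [this]
    refine (norm_add_le _ _).trans ?_
    rw [norm_mul]
    nlinarith [hun i, hu i, hb i, norm_nonneg (b i - 1), norm_nonneg (u i)]
  have h3 : Fintype.card ι * (2 / 5 * ‖w‖) ≤ ‖∑ i, b i * u i‖ := by
    have := norm_sub_norm_le ((Fintype.card ι : ℂ) * w) (∑ i, b i * u i)
    rw [norm_sub_rev] at this
    simp only [norm_mul, Complex.norm_natCast] at this
    linarith
  refine ⟨fun h => ?_, by linarith⟩
  rw [h, norm_zero] at h3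
  have : 0 < Fintype.card ι * (2 / 5 * ‖w‖) := by positivity
  linarith

/-- The permanent does not vanish near the all-ones matrix, and changing one column changes it by
a bounded factor. -/
theorem permanent_near_ones (n : ℕ) :
    (∀ A : Matrix (Fin n) (Fin n) ℂ, NearOnes A → A.permanent ≠ 0) ∧
    ∀ A B : Matrix (Fin n) (Fin n) ℂ, NearOnes A → NearOnes B → ∀ c,
      (∀ i j, j ≠ c → A i j = B i j) →
      ‖A.permanent - B.permanent‖ ≤ 1 / 2 * ‖B.permanent‖ := by
  induction n with
  | zero => exact ⟨fun A _ => by simp [Matrix.permanent], fun A B _ _ c => c.elim0⟩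
  | succ n ih =>
    obtain ⟨ih0, ih1⟩ := ih
    have key : ∀ A B : Matrix (Fin (n + 1)) (Fin (n + 1)) ℂ, NearOnes A → NearOnes B →
        (∀ i j, i ≠ 0 → A i j = B i j) →
        B.permanent ≠ 0 ∧ ‖A.permanent - B.permanent‖ ≤ 1 / 2 * ‖B.permanent‖ := by
      intro A B hA hB hAB
      have hm : ∀ j, (Matrix.of fun i l : Fin n => A i.succ (Equiv.swap 0 j l.succ)) =
          Matrix.of fun i l : Fin n => B i.succ (Equiv.swap 0 j l.succ) := fun j => by
        ext i l
        exact hAB _ _ (Fin.succ_ne_zero i)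
      rw [Matrix.permanent_succ_row_zero A, Matrix.permanent_succ_row_zero B]
      simp only [hm]
      have hn : ∀ j, NearOnes (Matrix.of fun i l : Fin n => B i.succ (Equiv.swap 0 j l.succ)) :=
        fun j i l => hB _ _
      -- Both expansions along row 0 have the same minors, and the minor at column 0 serves as the
      -- reference value w.
      refine norm_sum_mul_perturb _ _ _ _ (ih0 _ (hn 0)) (fun j => hA 0 j) (fun j => hB 0 j) ?_
      intro j
      rcases Fin.eq_zero_or_eq_succ j with rfl | ⟨k, rfl⟩
      · simp
      -- Because minors are indexed through `swap 0 j`, those at columns 0 and k + 1 differ only in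
      -- their column k, which is the one-column change covered by the induction hypothesis.
      · refine ih1 _ _ (hn _) (hn 0) k fun i l hl => ?_
        simp only [Matrix.of_apply, Equiv.swap_self, Equiv.refl_apply]
        rw [Equiv.swap_apply_of_ne_of_ne (Fin.succ_ne_zero l)
          (fun h => hl (Fin.succ_injective _ h))]
    refine ⟨fun A hA => (key A A hA hA fun _ _ _ => rfl).1, fun A B hA hB c hAB => ?_⟩
    -- Moving column c to position 0 and transposing turns a change of column into a change of row
    -- 0, leaving the permanent unaltered.
    have := (key ((A.submatrix id (Equiv.swap 0 c)).transpose)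
      ((B.submatrix id (Equiv.swap 0 c)).transpose) (fun i j => hA _ _) (fun i j => hB _ _)
      fun i j hi => hAB _ _ fun h => hi (by
        simpa using congrArg (Equiv.swap 0 c) h)).2
    simpa only [Matrix.permanent_transpose, Matrix.permanent_permute_rows] using this

theorem NearOnes.permanent_ne_zero {n : ℕ} {A : Matrix (Fin n) (Fin n) ℂ} (h : NearOnes A) :
    A.permanent ≠ 0 := (permanent_near_ones n).1 A h

theorem NearOnes.norm_permanent_le {n : ℕ} {A : Matrix (Fin n) (Fin n) ℂ} (h : NearOnes A) :
    ‖A.permanent‖ ≤ n.factorial * Real.exp n := by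
  refine (norm_sum_le _ _).trans ?_
  refine (Finset.sum_le_card_nsmul _ _ (Real.exp n) fun σ _ => ?_).trans
    (by simp [Fintype.card_perm])
  rw [norm_prod]
  have h1 : ∀ i, ‖A (σ i) i‖ ≤ Real.exp 1 := fun i => by
    have h2 : ‖A (σ i) i‖ ≤ ‖A (σ i) i - 1‖ + 1 := by
      simpa using norm_add_le (A (σ i) i - 1) 1
    linarith [h (σ i) i, Real.add_one_le_exp 1]
  refine (Finset.prod_le_prod (fun _ _ => norm_nonneg _) fun i _ => h1 i).trans ?_
  simp [← Real.exp_nat_mul]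

/-! ### Logarithms of zero-free holomorphic functions -/

open Metric in
theorem Complex.exists_log_of_ne_zero_on_ball {Ψ : ℂ → ℂ} {R : ℝ}
    (hΨ : DifferentiableOn ℂ Ψ (ball 0 R)) (h0 : ∀ s ∈ ball (0 : ℂ) R, Ψ s ≠ 0) (h1 : Ψ 0 = 1)
    (hR : 0 < R) :
    ∃ f : ℂ → ℂ, f 0 = 0 ∧ (∀ s ∈ ball (0 : ℂ) R, HasDerivAt f (deriv Ψ s / Ψ s) s) ∧
      ∀ s ∈ ball (0 : ℂ) R, Complex.exp (f s) = Ψ s := by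
  obtain ⟨f, hf0, hf⟩ := ((hΨ.deriv isOpen_ball).div hΨ h0).isExactOn_ball.with_val_at 0 0
  refine ⟨f, hf0, hf, fun s hs => ?_⟩
  have hd : ∀ x ∈ ball (0 : ℂ) R, HasDerivAt (fun x => Ψ x * Complex.exp (-f x)) 0 x := by
    intro x hx
    have h2 := (hΨ.differentiableAt (isOpen_ball.mem_nhds hx)).hasDerivAt.mul (hf x hx).neg.cexp
    have h3 := h0 x hx
    have h4 : deriv Ψ x * Complex.exp ((-f) x) +
        Ψ x * (Complex.exp ((-f) x) * -(deriv Ψ / Ψ) x) = 0 := by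
      simp only [Pi.div_apply]
      field_simp
      ring
    rw [h4] at h2
    exact h2
  have hc := (convex_ball (0 : ℂ) R).is_const_of_fderivWithin_eq_zero (𝕜 := ℂ)
    (f := fun x => Ψ x * Complex.exp (-f x))
    (fun x hx => (hd x hx).differentiableAt.differentiableWithinAt)
    (fun x hx => by
      rw [fderivWithin_of_isOpen isOpen_ball hx, ← toSpanSingleton_deriv, (hd x hx).deriv]
      simp) hs (mem_ball_self hR)
  simp only [hf0, h1, neg_zero, Complex.exp_zero, mul_one] at hc
  rw [Complex.exp_neg] at hc
  field_simp at hc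
  exact hc.symm

open Metric in
/-- A zero-free holomorphic function on a disc, normalized like a standardized moment generating
function and of size at most `exp N`, has a logarithm which is cubically close to `s ^ 2 / 2`. -/
theorem exists_log_near_gaussian {Ψ : ℂ → ℂ} {R N : ℝ} (hR : 0 < R) (hN : 0 < N)
    (hΨ : DifferentiableOn ℂ Ψ (ball 0 R)) (h0 : ∀ s ∈ ball (0 : ℂ) R, Ψ s ≠ 0) (h1 : Ψ 0 = 1)
    (h2 : deriv Ψ 0 = 0) (h3 : deriv (deriv Ψ) 0 = 1)
    (hb : ∀ s ∈ ball (0 : ℂ) R, ‖Ψ s‖ ≤ Real.exp N) :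
    ∃ f : ℂ → ℂ, f 0 = 0 ∧ DifferentiableOn ℂ f (ball 0 R) ∧
      (∀ s ∈ ball (0 : ℂ) R, Complex.exp (f s) = Ψ s) ∧
      ∀ s ∈ ball (0 : ℂ) (R / 4), ‖deriv f s - s‖ ≤ 768 * N / R ^ 3 * ‖s‖ ^ 2 := by
  obtain ⟨f, hf0, hf, hfe⟩ := Complex.exists_log_of_ne_zero_on_ball hΨ h0 h1 hR
  have hfd : DifferentiableOn ℂ f (ball 0 R) :=
    fun s hs => (hf s hs).differentiableAt.differentiableWithinAt
  have hfd1 := hfd.deriv isOpen_ball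
  have hfd2 := hfd1.deriv isOpen_ball
  have hm0 : (0 : ℂ) ∈ ball (0 : ℂ) R := mem_ball_self hR
  refine ⟨f, hf0, hfd, hfe, ?_⟩
  -- The size of Ψ bounds only Re f, from above; Borel–Carathéodory makes this a bound on |f| at the
  -- price of halving the disc.
  have hbd : ∀ s : ℂ, ‖s‖ ≤ R / 2 → ‖f s‖ ≤ 2 * N := by
    intro s hs
    have hs' : s ∈ ball (0 : ℂ) R := by simp; linarith
    have hre : Set.MapsTo f (ball 0 R) {z | z.re ≤ N} := fun x hx => by
      have := hb x hx
      rw [← hfe x hx, Complex.norm_exp, Real.exp_le_exp] at this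
      exact this
    refine (Complex.borelCaratheodory_zero hN hfd hre hR hs' hf0).trans ?_
    rw [div_le_iff₀ (by linarith)]
    nlinarith
  -- Cauchy's estimate on circles of radius R/4: 3! · 2N / (R/4)³ = 768 N / R³.
  have hd3 : ∀ s ∈ ball (0 : ℂ) (R / 4), ‖deriv (deriv (deriv f)) s‖ ≤ 768 * N / R ^ 3 := by
    intro s hs
    have hs' : ‖s‖ < R / 4 := by simpa using hs
    have hsub : closedBall s (R / 4) ⊆ ball (0 : ℂ) R := fun x hx => by
      have h4 : ‖x - s‖ ≤ R / 4 := by simpa [dist_eq_norm] using hx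
      have : ‖x‖ ≤ ‖x - s‖ + ‖s‖ := by simpa using norm_add_le (x - s) s
      simp; linarith
    have := Complex.norm_iteratedDeriv_le_of_forall_mem_sphere_norm_le 3
      (show 0 < R / 4 by linarith) (f := f) (c := s) (C := 2 * N)
      (DifferentiableOn.diffContOnCl_ball hfd hsub) (fun x hx => hbd x (by
        have h4 : ‖x - s‖ = R / 4 := by simpa [dist_eq_norm] using hx
        have : ‖x‖ ≤ ‖x - s‖ + ‖s‖ := by simpa using norm_add_le (x - s) s
        linarith))
    simp only [iteratedDeriv_succ, iteratedDeriv_zero] at this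
    refine this.trans (le_of_eq ?_)
    norm_num [Nat.factorial]
    field_simp
    norm_num
  have hsubset : ball (0 : ℂ) (R / 4) ⊆ ball 0 R := ball_subset_ball (by linarith)
  have e1 : deriv f 0 = 0 := by rw [(hf 0 hm0).deriv, h2, zero_div]
  have e2 : deriv (deriv f) 0 = 1 := by
    have hev : deriv f =ᶠ[nhds 0] fun s => deriv Ψ s / Ψ s := by
      filter_upwards [isOpen_ball.mem_nhds hm0] with s hs using (hf s hs).deriv
    rw [hev.deriv_eq]
    have := (((hΨ.deriv isOpen_ball).differentiableAt (isOpen_ball.mem_nhds hm0)).hasDerivAt.div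
      (hΨ.differentiableAt (isOpen_ball.mem_nhds hm0)).hasDerivAt (h0 0 hm0)).deriv
    rw [show (fun s => deriv Ψ s / Ψ s) = deriv Ψ / Ψ from rfl, this, h1, h2, h3]
    simp
  have hd2 : ∀ s ∈ ball (0 : ℂ) (R / 4), ‖deriv (deriv f) s - 1‖ ≤ 768 * N / R ^ 3 * ‖s‖ := by
    intro s hs
    have := (convex_ball (0 : ℂ) (R / 4)).norm_image_sub_le_of_norm_deriv_le (𝕜 := ℂ)
      (fun x hx => hfd2.differentiableAt (isOpen_ball.mem_nhds (hsubset hx))) hd3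
      (mem_ball_self (by linarith)) hs
    simpa [e2] using this
  intro s hs
  have hs' : ‖s‖ < R / 4 := by simpa using hs
  have hsub2 : closedBall (0 : ℂ) ‖s‖ ⊆ ball 0 (R / 4) := closedBall_subset_ball hs'
  have hh : ∀ x ∈ closedBall (0 : ℂ) ‖s‖,
      HasDerivAt (fun x => deriv f x - x) (deriv (deriv f) x - 1) x := fun x hx =>
    (hfd1.differentiableAt (isOpen_ball.mem_nhds (hsubset (hsub2 hx)))).hasDerivAt.sub
      (hasDerivAt_id x)
  have := (convex_closedBall (0 : ℂ) ‖s‖).norm_image_sub_le_of_norm_deriv_le (𝕜 := ℂ)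
    (f := fun x => deriv f x - x) (C := 768 * N / R ^ 3 * ‖s‖)
    (fun x hx => (hh x hx).differentiableAt) (fun x hx => by
      rw [(hh x hx).deriv]
      refine (hd2 x (hsub2 hx)).trans ?_
      have : ‖x‖ ≤ ‖s‖ := by simpa using hx
      gcongr) (mem_closedBall_self (norm_nonneg s)) (show s ∈ closedBall (0 : ℂ) ‖s‖ by simp)
  simpa [e1, pow_two, mul_assoc] using this

/-! ### A band-limited smoothing kernel -/

theorem norm_charFun_unitInterval_le (x : ℝ) :
    |x| * ‖charFun (volume.restrict (Set.Icc (0 : ℝ) 1)) x‖ ≤ 2 := by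
  rcases eq_or_ne x 0 with rfl | hx
  · simp
  rw [charFun_apply_real, integral_Icc_eq_integral_Ioc,
    ← intervalIntegral.integral_of_le zero_le_one]
  have hc : (x * Complex.I : ℂ) ≠ 0 := by simp [hx]
  have h1 : ∀ y : ℝ, Complex.exp (x * y * Complex.I) = Complex.exp ((x * Complex.I) * y) :=
    fun y => by ring_nf
  simp only [h1]
  rw [integral_exp_mul_complex hc, norm_div, norm_mul, Complex.norm_I, mul_one, Complex.norm_real,
    Real.norm_eq_abs, mul_div_cancel₀ _ (abs_ne_zero.2 hx)]
  refine (norm_sub_le _ _).trans ?_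
  have h2 : ∀ y : ℝ, ‖Complex.exp ((x * Complex.I) * y)‖ = 1 := fun y => by
    rw [← h1, ← Complex.ofReal_mul, Complex.norm_exp_ofReal_mul_I]
  rw [h2, h2]
  norm_num

theorem norm_charFun_unitInterval_sub_one_le (x : ℝ) :
    ‖charFun (volume.restrict (Set.Icc (0 : ℝ) 1)) x - 1‖ ≤ |x| / 2 := by
  have h0 : (1 : ℂ) = ∫ y in Set.Icc (0 : ℝ) 1, (1 : ℂ) := by simp
  have hi : IntegrableOn (fun y : ℝ => Complex.exp (x * y * Complex.I)) (Set.Icc 0 1) :=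
    (by fun_prop : Continuous _).continuousOn.integrableOn_Icc
  rw [charFun_apply_real, h0, ← integral_sub hi (by simp)]
  refine (norm_integral_le_of_norm_le (g := fun y => |x| * y)
    ((by fun_prop : Continuous _).continuousOn.integrableOn_Icc) ?_).trans ?_
  · filter_upwards [ae_restrict_mem measurableSet_Icc] with y hy
    rw [← Complex.ofReal_mul, mul_comm]
    refine (Real.norm_exp_I_mul_ofReal_sub_one_le).trans ?_
    rw [Real.norm_eq_abs, abs_mul, abs_of_nonneg hy.1]
  · rw [integral_Icc_eq_integral_Ioc, ← intervalIntegral.integral_of_le zero_le_one,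
      intervalIntegral.integral_const_mul, integral_id]
    linarith

theorem MeasureTheory.Measure.conv_le_volume {σ η : Measure ℝ} [IsProbabilityMeasure σ] [SFinite η]
    (hη : η ≤ volume) : σ.conv η ≤ volume := by
  refine Measure.le_intro fun s hs _ => ?_
  rw [← lintegral_indicator_one hs, Measure.lintegral_conv (by fun_prop (disch := exact hs))]
  calc ∫⁻ x, ∫⁻ y, s.indicator 1 (x + y) ∂η ∂σ
      ≤ ∫⁻ x, volume s ∂σ := by
        refine lintegral_mono fun x => (lintegral_mono' hη le_rfl).trans ?_
        rw [lintegral_add_left_eq_self (fun y => s.indicator 1 y) x, lintegral_indicator_one hs]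
    _ = volume s := by simp

/-- A smoothing kernel: a characteristic function `k` with values in `[0, 1]`, quartic decay, and
spectral measure `ρ` of bounded density supported in `[-2, 2]`. -/
structure IsSmoothingKernel (ρ : Measure ℝ) (k : ℝ → ℝ) : Prop where
  isProbabilityMeasure : IsProbabilityMeasure ρ
  le_volume : ρ ≤ volume
  abs_le_two : ∀ᵐ v ∂ρ, |v| ≤ 2
  charFun_eq : ∀ x, charFun ρ x = k x
  continuous : Continuous k
  nonneg : ∀ x, 0 ≤ k x
  le_one : ∀ x, k x ≤ 1
  decay : ∀ x, k x ≤ 64 * ((1 + x ^ 2)⁻¹) ^ 2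
  lower : ∀ x, |x| ≤ 1 → 1 / 16 ≤ k x

/-- With φ the characteristic function of the uniform law on [0, 1], |φ|⁴ belongs to the sum of four
independent variables, two uniform on [0, 1] and two on [-1, 0]; this gives the support and the
density bound. The decay comes from |xφ(x)| ≤ 2, the lower bound from |φ(x) - 1| ≤ |x|/2. -/
theorem exists_isSmoothingKernel : ∃ ρ k, IsSmoothingKernel ρ k := by
  set η : Measure ℝ := volume.restrict (Set.Icc (0 : ℝ) 1) with hη
  have hηp : IsProbabilityMeasure η := ⟨by simp [hη]⟩
  set η' : Measure ℝ := η.map (fun x => (-1) * x) with hη'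
  have hη'p : IsProbabilityMeasure η' := Measure.isProbabilityMeasure_map (by fun_prop)
  have hη'c : ∀ x, charFun η' x = (starRingEnd ℂ) (charFun η x) := fun x => by
    rw [hη', charFun_map_mul, neg_one_mul, charFun_neg]
  refine ⟨(η'.conv η').conv (η.conv η), fun x => ‖charFun η x‖ ^ 4, inferInstance, ?_, ?_, ?_, ?_,
    fun x => by positivity, fun x => ?_, fun x => ?_, fun x hx => ?_⟩
  · exact Measure.conv_le_volume (Measure.conv_le_volume Measure.restrict_le_self)
  · have h1 : ∀ᵐ v ∂η, v ∈ Set.Icc (0 : ℝ) 1 := ae_restrict_mem measurableSet_Icc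
    have h2 : ∀ᵐ v ∂η', v ∈ Set.Icc (-1 : ℝ) 0 := by
      refine (ae_map_iff (by fun_prop) measurableSet_Icc).2 ?_
      filter_upwards [h1] with v hv
      constructor <;> linarith [hv.1, hv.2]
    have hadd : ∀ {m m' : Measure ℝ} [IsProbabilityMeasure m] [IsProbabilityMeasure m']
        {a b c d : ℝ}, (∀ᵐ v ∂m, v ∈ Set.Icc a b) → (∀ᵐ v ∂m', v ∈ Set.Icc c d) →
        ∀ᵐ v ∂(m.conv m'), v ∈ Set.Icc (a + c) (b + d) := by
      intro m m' _ _ a b c d hm hm'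
      refine (ae_map_iff (by fun_prop) measurableSet_Icc).2 ?_
      filter_upwards [Measure.quasiMeasurePreserving_fst.ae hm,
        Measure.quasiMeasurePreserving_snd.ae hm'] with p h1 h2
      exact ⟨add_le_add h1.1 h2.1, add_le_add h1.2 h2.2⟩
    filter_upwards [hadd (hadd h2 h2) (hadd h1 h1)] with v hv
    rw [abs_le]
    constructor <;> linarith [hv.1, hv.2]
  · intro x
    rw [charFun_conv, charFun_conv, charFun_conv, hη'c]
    have := Complex.conj_mul' (charFun η x)
    push_cast
    linear_combination ((starRingEnd ℂ) (charFun η x) * charFun η x + (‖charFun η x‖ : ℂ) ^ 2) * this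
  · have : Continuous (charFun η) := continuous_charFun
    fun_prop
  · exact pow_le_one₀ (norm_nonneg _) (norm_charFun_le_one x)
  · have h1 : ‖charFun η x‖ ≤ 1 := norm_charFun_le_one x
    have h2 := norm_charFun_unitInterval_le x
    rw [← hη] at h2
    have h0 := norm_nonneg (charFun η x)
    have h3 : x ^ 2 * ‖charFun η x‖ ^ 2 ≤ 4 := by
      rw [← sq_abs, ← mul_pow]
      have : 0 ≤ |x| * ‖charFun η x‖ := by positivity
      nlinarith
    have h4 : (1 + x ^ 2) * ‖charFun η x‖ ^ 2 ≤ 8 := by nlinarith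
    have h5 : ((1 + x ^ 2) * ‖charFun η x‖ ^ 2) ^ 2 ≤ 8 ^ 2 := by gcongr
    change ‖charFun η x‖ ^ 4 ≤ _
    rw [inv_pow, ← div_eq_mul_inv, le_div_iff₀ (by positivity)]
    linarith
  · have h1 := norm_charFun_unitInterval_sub_one_le x
    rw [← hη] at h1
    have h2 : (1 : ℝ) ≤ ‖charFun η x - 1‖ + ‖charFun η x‖ := by
      have := norm_sub_le (charFun η x) (charFun η x - 1)
      simp only [sub_sub_cancel, norm_one] at this
      linarith
    have h3 : 1 / 2 ≤ ‖charFun η x‖ := by linarith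
    calc (1 : ℝ) / 16 = (1 / 2) ^ 4 := by norm_num
      _ ≤ ‖charFun η x‖ ^ 4 := by gcongr

/-! ### Esseen smoothing -/

/-- The characteristic function of `ν` is close to the standard Gaussian one on `[-T, T]`. -/
def CharFunNearGaussian (ν : Measure ℝ) (A T : ℝ) : Prop :=
  ∀ t : ℝ, |t| ≤ T →
    ‖charFun ν t - Real.exp (-t ^ 2 / 2)‖ ≤ A * |t| * Real.exp (-t ^ 2 / 8)

theorem charFunNearGaussian_gaussianReal (T : ℝ) :
    CharFunNearGaussian (gaussianReal 0 1) 0 T := by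
  intro t _
  rw [charFun_gaussianReal]
  simp only [zero_mul]
  rw [norm_le_zero_iff, sub_eq_zero]
  push_cast
  congr 1
  ring

/-- Uniform in the length of the interval: the singularity 1/|x| is later cancelled by the factor
|t| in `CharFunNearGaussian`. -/
theorem abs_mul_norm_integral_exp_le (a b x : ℝ) :
    |x| * ‖∫ u in Set.Ioc a b, Complex.exp (-(x * u) * Complex.I)‖ ≤ 2 := by
  rcases le_total b a with hab | hab
  · simp [Set.Ioc_eq_empty (not_lt.2 hab)]
  rcases eq_or_ne x 0 with rfl | hx
  · simp
  rw [← intervalIntegral.integral_of_le hab]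
  have hc : (-(x * Complex.I) : ℂ) ≠ 0 := by simp [hx]
  have h1 : ∀ y : ℝ, Complex.exp (-(x * y) * Complex.I) = Complex.exp (-(x * Complex.I) * y) :=
    fun y => by ring_nf
  simp only [h1]
  rw [integral_exp_mul_complex hc, norm_div, norm_neg, norm_mul, Complex.norm_I, mul_one,
    Complex.norm_real, Real.norm_eq_abs, mul_div_cancel₀ _ (abs_ne_zero.2 hx)]
  refine (norm_sub_le _ _).trans ?_
  have h2 : ∀ y : ℝ, ‖Complex.exp (-(x * Complex.I) * y)‖ = 1 := fun y => by
    rw [← h1, ← Complex.ofReal_mul, ← Complex.ofReal_neg, Complex.norm_exp_ofReal_mul_I]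
  rw [h2, h2]
  norm_num

theorem integral_exp_neg_scaled_sq_le {τ c : ℝ} (hτ : 0 < τ) (hc : 0 < c) (hc' : c ≤ 16) :
    Integrable (fun v : ℝ => Real.exp (-(τ * v) ^ 2 / c)) ∧
      ∫ v : ℝ, Real.exp (-(τ * v) ^ 2 / c) ≤ 8 / τ := by
  have h : (fun v : ℝ => Real.exp (-(τ * v) ^ 2 / c)) =
      fun v => Real.exp (-(τ ^ 2 / c) * v ^ 2) := by
    ext v
    congr 1
    ring
  rw [h]
  refine ⟨integrable_exp_neg_mul_sq (by positivity), ?_⟩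
  rw [integral_gaussian, Real.sqrt_le_left (by positivity), div_pow, div_div_eq_mul_div]
  gcongr
  nlinarith [Real.pi_lt_four, Real.pi_pos]

namespace IsSmoothingKernel

variable {ρ : Measure ℝ} {k : ℝ → ℝ} (hk : IsSmoothingKernel ρ k)
include hk

theorem integrable : Integrable k := by
  refine Integrable.mono' (integrable_inv_one_add_sq.const_mul 64)
    hk.continuous.aestronglyMeasurable (ae_of_all _ fun x => ?_)
  rw [Real.norm_eq_abs, abs_of_nonneg (hk.nonneg x)]
  refine (hk.decay x).trans ?_
  have h1 : (1 + x ^ 2)⁻¹ ≤ 1 := inv_le_one_of_one_le₀ (by nlinarith)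
  have h2 : 0 ≤ (1 + x ^ 2)⁻¹ := by positivity
  nlinarith

theorem integral_pos : 0 < ∫ x, k x := by
  rw [integral_pos_iff_support_of_nonneg hk.nonneg hk.integrable]
  have h : Set.Icc (-1 : ℝ) 1 ⊆ Function.support k := fun x hx => by
    have := hk.lower x (abs_le.2 hx)
    exact (by linarith : 0 < k x).ne'
  refine lt_of_lt_of_le ?_ (measure_mono h)
  simp

/-- Parseval's identity. -/
theorem integral_translate_eq (ν : Measure ℝ) [IsProbabilityMeasure ν] (τ u : ℝ) :
    ((∫ y, k (τ * (y - u)) ∂ν : ℝ) : ℂ) =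
      ∫ v, charFun ν (τ * v) * Complex.exp (-(τ * v * u) * Complex.I) ∂ρ := by
  have := hk.isProbabilityMeasure
  rw [← integral_complex_ofReal]
  simp only [← hk.charFun_eq, charFun_apply_real]
  rw [integral_integral_swap]
  · refine integral_congr_ae (ae_of_all _ fun v => ?_)
    simp only
    rw [← integral_mul_const]
    refine integral_congr_ae (ae_of_all _ fun y => ?_)
    simp only
    rw [← Complex.exp_add]
    congr 1
    push_cast
    ring
  · refine Integrable.of_bound (by fun_prop) 1 (ae_of_all _ fun p => ?_)
    simp only [Function.uncurry]
    rw [← Complex.ofReal_mul, Complex.norm_exp_ofReal_mul_I]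

theorem integral_le_of_bound {g : ℝ → ℝ} {G : ℝ → ℝ} (hg : ∀ᵐ v ∂ρ, g v ≤ G v)
    (hg0 : ∀ v, 0 ≤ g v) (hG0 : ∀ v, 0 ≤ G v) (hG : Integrable G) :
    ∫ v, g v ∂ρ ≤ ∫ v, G v := by
  have hGρ : Integrable G ρ := hG.mono_measure hk.le_volume
  exact (integral_mono_of_nonneg (ae_of_all _ hg0) hGρ hg).trans
    (integral_mono_measure hk.le_volume (ae_of_all _ hG0) hG)

/-- Concentration at scale `1 / τ`. -/
theorem integral_translate_le {ν : Measure ℝ} [IsProbabilityMeasure ν] {A τ : ℝ} (hτ : 0 < τ)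
    (hA : A ≤ 1) (hν : CharFunNearGaussian ν A (2 * τ)) (u : ℝ) :
    ∫ y, k (τ * (y - u)) ∂ν ≤ 32 / τ := by
  have h1 : ∫ y, k (τ * (y - u)) ∂ν ≤ ∫ v, ‖charFun ν (τ * v)‖ ∂ρ := by
    have h2 := hk.integral_translate_eq ν τ u
    have h3 : ∫ y, k (τ * (y - u)) ∂ν ≤ ‖((∫ y, k (τ * (y - u)) ∂ν : ℝ) : ℂ)‖ := by
      rw [Complex.norm_real]
      exact le_abs_self _
    refine h3.trans ?_
    rw [h2]
    refine (norm_integral_le_integral_norm _).trans (le_of_eq ?_)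
    refine integral_congr_ae (ae_of_all _ fun v => ?_)
    simp only
    rw [norm_mul, ← Complex.ofReal_mul, ← Complex.ofReal_mul, ← Complex.ofReal_neg,
      Complex.norm_exp_ofReal_mul_I, mul_one]
  obtain ⟨hi, hb⟩ := integral_exp_neg_scaled_sq_le hτ (c := 16) (by norm_num) le_rfl
  refine h1.trans ((hk.integral_le_of_bound (G := fun v => 4 * Real.exp (-(τ * v) ^ 2 / 16)) ?_
    (fun v => norm_nonneg _) (fun v => by positivity) (hi.const_mul 4)).trans ?_)
  · filter_upwards [hk.abs_le_two] with v hv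
    set x := τ * v with hx
    have hxT : |x| ≤ 2 * τ := by
      rw [hx, abs_mul, abs_of_pos hτ]
      nlinarith
    have h2 := hν x hxT
    have h3 : ‖charFun ν x‖ ≤
        ‖charFun ν x - Real.exp (-x ^ 2 / 2)‖ + Real.exp (-x ^ 2 / 2) := by
      have := norm_add_le (charFun ν x - Real.exp (-x ^ 2 / 2)) (Real.exp (-x ^ 2 / 2) : ℂ)
      rw [sub_add_cancel, Complex.norm_real, Real.norm_eq_abs, abs_of_pos (Real.exp_pos _)] at this
      exact this
    have h4 : Real.exp (-x ^ 2 / 2) ≤ Real.exp (-x ^ 2 / 16) := by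
      rw [Real.exp_le_exp]
      nlinarith [sq_nonneg x]
    have h5 : A * |x| * Real.exp (-x ^ 2 / 8) ≤ 3 * Real.exp (-x ^ 2 / 16) := by
      have h6 : Real.exp (-x ^ 2 / 8) = Real.exp (-x ^ 2 / 16) * Real.exp (-x ^ 2 / 16) := by
        rw [← Real.exp_add]; congr 1; ring
      have h7 : |x| ≤ 3 * Real.exp (x ^ 2 / 16) := by
        have := Real.add_one_le_exp (x ^ 2 / 16)
        rw [← sq_abs] at this ⊢
        nlinarith [sq_nonneg (|x| - 8 / 3)]
      have h8 : |x| * Real.exp (-x ^ 2 / 16) ≤ 3 := by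
        have h9 : Real.exp (-x ^ 2 / 16) = (Real.exp (x ^ 2 / 16))⁻¹ := by
          rw [← Real.exp_neg]; congr 1; ring
        rw [h9, ← div_eq_mul_inv, div_le_iff₀ (Real.exp_pos _)]
        exact h7
      rw [h6]
      have h10 := Real.exp_pos (-x ^ 2 / 16)
      have h11 : A * (|x| * Real.exp (-x ^ 2 / 16)) ≤ 3 := by
        have : 0 ≤ |x| * Real.exp (-x ^ 2 / 16) := by positivity
        nlinarith
      nlinarith
    linarith
  · rw [integral_const_mul]
    have : (32 : ℝ) / τ = 4 * (8 / τ) := by ring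
    linarith

/-- On |v - x| ≤ 1 the kernel is at least 1/16 and 1 + v² ≤ 3(1 + x²), so a window of length 2
already yields the factor 2/48. This lets concentration estimates for k pass to the heavier-tailed
(1 + x²)⁻¹. -/
theorem inv_one_add_sq_le_conv (x : ℝ) :
    (1 + x ^ 2)⁻¹ ≤ 24 * ∫ v, (1 + v ^ 2)⁻¹ * k (x - v) := by
  have hint : Integrable fun v : ℝ => (1 + v ^ 2)⁻¹ * k (x - v) := by
    refine Integrable.mono' integrable_inv_one_add_sq (by
      have := hk.continuous
      have h2 : Continuous fun v : ℝ => (1 + v ^ 2)⁻¹ :=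
        Continuous.inv₀ (by fun_prop) fun v => by positivity
      exact (by fun_prop : Continuous _).aestronglyMeasurable) (ae_of_all _ fun v => ?_)
    rw [norm_mul, Real.norm_eq_abs, Real.norm_eq_abs, abs_of_nonneg (hk.nonneg _),
      abs_of_pos (by positivity)]
    exact mul_le_of_le_one_right (by positivity) (hk.le_one _)
  have h1 : ∫ v in Set.Icc (x - 1) (x + 1), (1 + x ^ 2)⁻¹ / 48 ≤
      ∫ v in Set.Icc (x - 1) (x + 1), (1 + v ^ 2)⁻¹ * k (x - v) := by
    refine setIntegral_mono_on (by simp) hint.integrableOn measurableSet_Icc fun v hv => ?_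
    have h2 := hk.lower (x - v) (by rw [abs_le]; constructor <;> linarith [hv.1, hv.2])
    have h3 : (1 + x ^ 2)⁻¹ / 3 ≤ (1 + v ^ 2)⁻¹ := by
      rw [div_le_iff₀ (by norm_num), ← inv_le_inv₀ (by positivity) (by positivity), inv_inv,
        mul_inv, inv_inv]
      nlinarith [mul_nonneg (sub_nonneg.2 hv.1) (sub_nonneg.2 hv.2), sq_nonneg (v - 2 * x)]
    calc (1 + x ^ 2)⁻¹ / 48 = (1 + x ^ 2)⁻¹ / 3 * (1 / 16) := by ring
      _ ≤ _ := by gcongr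
  have h4 := setIntegral_le_integral (s := Set.Icc (x - 1) (x + 1)) hint
    (ae_of_all _ fun v => mul_nonneg (by positivity) (hk.nonneg _))
  have h5 : ∫ v in Set.Icc (x - 1) (x + 1), (1 + x ^ 2)⁻¹ / 48 = (1 + x ^ 2)⁻¹ / 24 := by
    simp
    ring
  linarith

theorem integral_inv_one_add_sq_le {ν : Measure ℝ} [IsProbabilityMeasure ν] {A τ : ℝ}
    (hτ : 0 < τ) (hA : A ≤ 1) (hν : CharFunNearGaussian ν A (2 * τ)) (a : ℝ) :
    ∫ y, (1 + (τ * (y - a)) ^ 2)⁻¹ ∂ν ≤ 3072 / τ := by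
  have hkc := hk.continuous
  have hint : Integrable (Function.uncurry fun y v : ℝ => (1 + v ^ 2)⁻¹ * k (τ * (y - a) - v))
      (ν.prod volume) := by
    refine Integrable.mono' (g := fun p => (1 + p.2 ^ 2)⁻¹)
      (integrable_inv_one_add_sq.comp_snd ν) ?_ (ae_of_all _ fun p => ?_)
    · have h2 : Continuous fun p : ℝ × ℝ => (1 + p.2 ^ 2)⁻¹ :=
        Continuous.inv₀ (by fun_prop) fun v => by positivity
      exact (by fun_prop : Continuous fun p : ℝ × ℝ =>
        (1 + p.2 ^ 2)⁻¹ * k (τ * (p.1 - a) - p.2)).aestronglyMeasurable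
    · simp only [Function.uncurry]
      rw [norm_mul, Real.norm_eq_abs, Real.norm_eq_abs, abs_of_nonneg (hk.nonneg _),
        abs_of_pos (by positivity)]
      exact mul_le_of_le_one_right (by positivity) (hk.le_one _)
  calc ∫ y, (1 + (τ * (y - a)) ^ 2)⁻¹ ∂ν
      ≤ ∫ y, 24 * (∫ v, (1 + v ^ 2)⁻¹ * k (τ * (y - a) - v)) ∂ν := by
        refine integral_mono_of_nonneg (ae_of_all _ fun y => by positivity) ?_
          (ae_of_all _ fun y => hk.inv_one_add_sq_le_conv _)
        exact hint.integral_prod_left.const_mul 24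
    _ = 24 * ∫ v : ℝ, (1 + v ^ 2)⁻¹ * ∫ y, k (τ * (y - (a + v / τ))) ∂ν := by
        rw [integral_const_mul, integral_integral_swap hint]
        congr 1
        refine integral_congr_ae (ae_of_all _ fun v => ?_)
        simp only
        rw [← integral_const_mul]
        refine integral_congr_ae (ae_of_all _ fun y => ?_)
        simp only
        congr 2
        field_simp
        ring
    _ ≤ 24 * ∫ v : ℝ, (1 + v ^ 2)⁻¹ * (32 / τ) := by
        refine mul_le_mul_of_nonneg_left ?_ (by norm_num)
        refine integral_mono_of_nonneg (ae_of_all _ fun v => ?_)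
          (integrable_inv_one_add_sq.mul_const _) (ae_of_all _ fun v => ?_)
        · exact mul_nonneg (by positivity) (integral_nonneg fun _ => hk.nonneg _)
        · simp only
          exact mul_le_mul_of_nonneg_left (hk.integral_translate_le hτ hA hν _) (by positivity)
    _ = Real.pi * (768 / τ) := by
        rw [integral_mul_const, integral_univ_inv_one_add_sq]
        ring
    _ ≤ 4 * (768 / τ) := by
        gcongr
        exact Real.pi_lt_four.le
    _ = 3072 / τ := by ring

end IsSmoothingKernel

namespace IsSmoothingKernel

variable {ρ : Measure ℝ} {k : ℝ → ℝ} (hk : IsSmoothingKernel ρ k)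
include hk

theorem setIntegral_le_of_sq_le {s : Set ℝ} (hs : MeasurableSet s) {x : ℝ}
    (hx : ∀ v ∈ s, x ^ 2 ≤ v ^ 2) : ∫ v in s, k v ≤ 256 * (1 + x ^ 2)⁻¹ := by
  calc ∫ v in s, k v ≤ ∫ v in s, 64 * (1 + x ^ 2)⁻¹ * (1 + v ^ 2)⁻¹ := by
        refine setIntegral_mono_on hk.integrable.integrableOn
          (integrable_inv_one_add_sq.const_mul _).integrableOn hs fun v hv => ?_
        refine (hk.decay v).trans ?_
        have : (1 + v ^ 2)⁻¹ ≤ (1 + x ^ 2)⁻¹ := by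
          rw [inv_le_inv₀ (by positivity) (by positivity)]
          linarith [hx v hv]
        rw [pow_two, mul_assoc]
        gcongr
    _ ≤ ∫ v : ℝ, 64 * (1 + x ^ 2)⁻¹ * (1 + v ^ 2)⁻¹ :=
        setIntegral_le_integral (integrable_inv_one_add_sq.const_mul _)
          (ae_of_all _ fun v => by positivity)
    _ = 64 * (1 + x ^ 2)⁻¹ * Real.pi := by
        rw [integral_const_mul, integral_univ_inv_one_add_sq]
    _ ≤ 64 * (1 + x ^ 2)⁻¹ * 4 := by
        gcongr
        exact Real.pi_lt_four.le
    _ = 256 * (1 + x ^ 2)⁻¹ := by ring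

theorem abs_integral_Iic_sub_le (x : ℝ) :
    |(∫ v in Set.Iic x, k v) - (if 0 < x then ∫ v, k v else 0)| ≤ 256 * (1 + x ^ 2)⁻¹ := by
  split_ifs with h
  · have h1 := integral_add_compl (measurableSet_Iic (a := x)) hk.integrable
    rw [Set.compl_Iic] at h1
    have h2 : ∫ v in Set.Ioi x, k v ≤ 256 * (1 + x ^ 2)⁻¹ :=
      hk.setIntegral_le_of_sq_le measurableSet_Ioi fun v hv => by
        have : x < v := hv
        nlinarith
    have h3 : 0 ≤ ∫ v in Set.Ioi x, k v := integral_nonneg fun v => hk.nonneg v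
    rw [abs_le]
    constructor <;> linarith
  · rw [sub_zero, abs_of_nonneg (integral_nonneg fun v => hk.nonneg v)]
    refine hk.setIntegral_le_of_sq_le measurableSet_Iic fun v hv => ?_
    have : v ≤ x := hv
    nlinarith

theorem integral_Ioc_translate_eq {τ a b : ℝ} (hab : a < b) (y : ℝ) :
    τ * ∫ u in Set.Ioc a b, k (τ * (y - u)) =
      (∫ v in Set.Iic (τ * (y - a)), k v) - ∫ v in Set.Iic (τ * (y - b)), k v := by
  rw [intervalIntegral.integral_Iic_sub_Iic hk.integrable.integrableOn hk.integrable.integrableOn,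
    ← intervalIntegral.integral_of_le hab.le]
  have h := intervalIntegral.mul_integral_comp_sub_mul (f := k) (a := a) (b := b) τ (τ * y)
  simp only [mul_sub]
  exact h

/-- The smoothed indicator of an interval is close to the indicator. -/
theorem abs_smoothed_sub_indicator_le {τ a b : ℝ} (hτ : 0 < τ) (hab : a < b) (y : ℝ) :
    |(τ * ∫ u in Set.Ioc a b, k (τ * (y - u))) -
      (∫ v, k v) * (Set.Ioc a b).indicator 1 y| ≤
      256 * (1 + (τ * (y - a)) ^ 2)⁻¹ + 256 * (1 + (τ * (y - b)) ^ 2)⁻¹ := by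
  rw [hk.integral_Ioc_translate_eq hab]
  have h1 := hk.abs_integral_Iic_sub_le (τ * (y - a))
  have h2 := hk.abs_integral_Iic_sub_le (τ * (y - b))
  -- The indicator is a difference of two steps; the strict inequality in each step matches an
  -- interval open at a and closed at b.
  have h3 : (∫ v, k v) * (Set.Ioc a b).indicator 1 y =
      (if 0 < τ * (y - a) then ∫ v, k v else 0) - (if 0 < τ * (y - b) then ∫ v, k v else 0) := by
    simp only [mul_pos_iff_of_pos_left hτ, sub_pos, Set.indicator_apply, Set.mem_Ioc, Pi.one_apply]
    by_cases ha : a < y <;> by_cases hb : b < y <;> simp [ha, hb]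
    all_goals linarith
  rw [h3]
  rw [abs_le] at h1 h2 ⊢
  constructor <;> linarith [h1.1, h1.2, h2.1, h2.2]

theorem integrable_uncurry_translate (ν : Measure ℝ) [IsProbabilityMeasure ν] (τ a b : ℝ) :
    Integrable (Function.uncurry fun y u : ℝ => k (τ * (y - u)))
      (ν.prod (volume.restrict (Set.Ioc a b))) := by
  have := hk.continuous
  refine Integrable.of_bound (by
    exact (by fun_prop : Continuous fun p : ℝ × ℝ => k (τ * (p.1 - p.2))).aestronglyMeasurable) 1
    (ae_of_all _ fun p => ?_)
  simp only [Function.uncurry]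
  rw [Real.norm_eq_abs, abs_of_nonneg (hk.nonneg _)]
  exact hk.le_one _

/-- Smoothing errs only near the two endpoints, and `integral_inv_one_add_sq_le` says that ν puts
mass O(1/τ) there. -/
theorem abs_measure_sub_smoothed_le {ν : Measure ℝ} [IsProbabilityMeasure ν] {A τ a b : ℝ}
    (hτ : 0 < τ) (hab : a < b) (hA : A ≤ 1) (hν : CharFunNearGaussian ν A (2 * τ)) :
    |(∫ y, (τ * ∫ u in Set.Ioc a b, k (τ * (y - u))) ∂ν) - (∫ v, k v) * ν.real (Set.Ioc a b)| ≤
      2 ^ 21 / τ := by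
  have hG : ∀ c : ℝ, Integrable (fun y => (1 + (τ * (y - c)) ^ 2)⁻¹) ν := fun c =>
    Integrable.of_bound (Continuous.aestronglyMeasurable
      (Continuous.inv₀ (by fun_prop) fun v => by positivity)) 1 (ae_of_all _ fun y => by
        rw [Real.norm_eq_abs, abs_of_pos (by positivity)]
        exact inv_le_one_of_one_le₀ (by nlinarith [sq_nonneg (τ * (y - c))]))
  have hψ : Integrable (fun y => τ * ∫ u in Set.Ioc a b, k (τ * (y - u))) ν :=
    (hk.integrable_uncurry_translate ν τ a b).integral_prod_left.const_mul τ
  have h1 : Integrable (fun y => (∫ v, k v) * (Set.Ioc a b).indicator 1 y) ν :=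
    ((integrable_const (1 : ℝ)).indicator measurableSet_Ioc).const_mul _
  have h2 : (∫ v, k v) * ν.real (Set.Ioc a b) =
      ∫ y, (∫ v, k v) * (Set.Ioc a b).indicator 1 y ∂ν := by
    rw [integral_const_mul, integral_indicator_one measurableSet_Ioc]
  rw [h2, ← integral_sub hψ h1, ← Real.norm_eq_abs]
  refine (norm_integral_le_of_norm_le (((hG a).const_mul 256).add ((hG b).const_mul 256))
    (ae_of_all _ fun y => hk.abs_smoothed_sub_indicator_le hτ hab y)).trans ?_
  simp only [Pi.add_apply]
  rw [integral_add ((hG a).const_mul 256) ((hG b).const_mul 256), integral_const_mul,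
    integral_const_mul]
  have h3 := hk.integral_inv_one_add_sq_le hτ hA hν a
  have h4 := hk.integral_inv_one_add_sq_le hτ hA hν b
  calc _ ≤ 256 * (3072 / τ) + 256 * (3072 / τ) := by gcongr
    _ = 1572864 / τ := by ring
    _ ≤ 2 ^ 21 / τ := by
        gcongr
        norm_num

/-- By Parseval the difference is an integral against ρ of the difference of characteristic
functions times the transform of the interval. The |t| of the first cancels the 1/|t| of the second,
and a Gaussian integral of size 8/τ remains to offset the factor τ. -/
theorem abs_smoothed_sub_smoothed_le {ν : Measure ℝ} [IsProbabilityMeasure ν] {A τ a b : ℝ}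
    (hτ : 0 < τ) (hA : 0 ≤ A) (hν : CharFunNearGaussian ν A (2 * τ)) :
    |(∫ y, (τ * ∫ u in Set.Ioc a b, k (τ * (y - u))) ∂ν) -
      ∫ y, (τ * ∫ u in Set.Ioc a b, k (τ * (y - u))) ∂(gaussianReal 0 1)| ≤ 16 * A := by
  have := hk.isProbabilityMeasure
  have hsw : ∀ m : Measure ℝ, IsProbabilityMeasure m →
      ∫ y, (τ * ∫ u in Set.Ioc a b, k (τ * (y - u))) ∂m =
        τ * ∫ u in Set.Ioc a b, ∫ y, k (τ * (y - u)) ∂m := fun m hm => by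
    rw [integral_const_mul, integral_integral_swap (hk.integrable_uncurry_translate m τ a b)]
  have hint : ∀ m : Measure ℝ, IsProbabilityMeasure m →
      Integrable (fun u => ∫ y, k (τ * (y - u)) ∂m) (volume.restrict (Set.Ioc a b)) :=
    fun m hm => (hk.integrable_uncurry_translate m τ a b).integral_prod_right
  rw [hsw ν inferInstance, hsw _ inferInstance, ← mul_sub,
    ← integral_sub (hint ν inferInstance) (hint _ inferInstance), abs_mul, abs_of_pos hτ]
  set d : ℝ → ℂ := fun t => charFun ν t - charFun (gaussianReal 0 1) t with hd
  have hdm : Measurable d := measurable_charFun.sub measurable_charFun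
  have hdb : ∀ t, ‖d t‖ ≤ 2 := fun t => by
    have h1 := norm_charFun_le_one (μ := ν) t
    have h2 := norm_charFun_le_one (μ := gaussianReal 0 1) t
    exact (norm_sub_le _ _).trans (by linarith)
  have hch : ∀ (m : Measure ℝ) (_ : IsProbabilityMeasure m) (u : ℝ), Integrable (fun v : ℝ =>
      charFun m (τ * v) * Complex.exp (-(τ * v * u) * Complex.I)) ρ := fun m hm u => by
    have hm1 : Measurable (charFun m) := measurable_charFun
    refine Integrable.of_bound (by fun_prop) 1 (ae_of_all _ fun v => ?_)
    rw [norm_mul, ← Complex.ofReal_mul, ← Complex.ofReal_mul, ← Complex.ofReal_neg,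
      Complex.norm_exp_ofReal_mul_I, mul_one]
    exact norm_charFun_le_one _
  have hD : ((∫ u in Set.Ioc a b,
      ((∫ y, k (τ * (y - u)) ∂ν) - ∫ y, k (τ * (y - u)) ∂(gaussianReal 0 1)) : ℝ) : ℂ) =
      ∫ v, d (τ * v) * (∫ u in Set.Ioc a b, Complex.exp (-((τ * v : ℝ) * u) * Complex.I)) ∂ρ := by
    rw [← integral_complex_ofReal]
    simp only [Complex.ofReal_sub, hk.integral_translate_eq]
    have h1 : ∀ u : ℝ, (∫ v, charFun ν (τ * v) * Complex.exp (-(τ * v * u) * Complex.I) ∂ρ) -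
        ∫ v, charFun (gaussianReal 0 1) (τ * v) * Complex.exp (-(τ * v * u) * Complex.I) ∂ρ =
        ∫ v, d (τ * v) * Complex.exp (-(τ * v * u) * Complex.I) ∂ρ := fun u => by
      rw [← integral_sub (hch ν inferInstance u) (hch _ inferInstance u)]
      simp only [hd, sub_mul]
    simp only [h1]
    rw [integral_integral_swap]
    · simp only [← integral_const_mul, Complex.ofReal_mul]
    · refine Integrable.of_bound ?_ 2 (ae_of_all _ fun p => ?_)
      · have : Measurable fun p : ℝ × ℝ =>
            d (τ * p.2) * Complex.exp (-(τ * p.2 * p.1) * Complex.I) := by fun_prop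
        exact this.aestronglyMeasurable
      · simp only [Function.uncurry]
        rw [norm_mul, ← Complex.ofReal_mul, ← Complex.ofReal_mul, ← Complex.ofReal_neg,
          Complex.norm_exp_ofReal_mul_I, mul_one]
        exact hdb _
  have hnorm := congrArg norm hD
  rw [Complex.norm_real, Real.norm_eq_abs] at hnorm
  rw [hnorm]
  obtain ⟨hi, hb⟩ := integral_exp_neg_scaled_sq_le hτ (c := 8) (by norm_num) (by norm_num)
  have h2 : ‖∫ v, d (τ * v) *
      (∫ u in Set.Ioc a b, Complex.exp (-((τ * v : ℝ) * u) * Complex.I)) ∂ρ‖ ≤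
      ∫ v, 2 * A * Real.exp (-(τ * v) ^ 2 / 8) := by
    refine (norm_integral_le_integral_norm _).trans (hk.integral_le_of_bound ?_
      (fun _ => norm_nonneg _) (fun _ => by positivity) (hi.const_mul (2 * A)))
    filter_upwards [hk.abs_le_two] with v hv
    have hxT : |τ * v| ≤ 2 * τ := by
      rw [abs_mul, abs_of_pos hτ]
      nlinarith
    have h3 : ‖d (τ * v)‖ ≤ A * |τ * v| * Real.exp (-(τ * v) ^ 2 / 8) := by
      have h4 := charFunNearGaussian_gaussianReal (2 * τ) (τ * v) hxT
      simp only [zero_mul, norm_le_zero_iff, sub_eq_zero] at h4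
      rw [hd]
      simp only [h4]
      exact hν _ hxT
    rw [norm_mul]
    calc _ ≤ A * |τ * v| * Real.exp (-(τ * v) ^ 2 / 8) *
          ‖∫ u in Set.Ioc a b, Complex.exp (-((τ * v : ℝ) * u) * Complex.I)‖ := by gcongr
      _ = A * Real.exp (-(τ * v) ^ 2 / 8) * (|τ * v| *
          ‖∫ u in Set.Ioc a b, Complex.exp (-((τ * v : ℝ) * u) * Complex.I)‖) := by ring
      _ ≤ A * Real.exp (-(τ * v) ^ 2 / 8) * 2 := by
          gcongr
          exact abs_mul_norm_integral_exp_le a b (τ * v)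
      _ = _ := by ring
  rw [integral_const_mul] at h2
  calc _ ≤ τ * (2 * A * (8 / τ)) := by
        gcongr
        exact h2.trans (by gcongr)
    _ = 16 * A := by
        field_simp
        ring

end IsSmoothingKernel

/-- **Esseen-type smoothing inequality**: closeness of characteristic functions on `[-T, T]`
controls the probabilities of intervals. -/
theorem exists_interval_prob_near_gaussian : ∃ C : ℝ, 0 < C ∧
    ∀ (ν : Measure ℝ) [IsProbabilityMeasure ν] (A T : ℝ), 0 ≤ A → 0 < T →
      CharFunNearGaussian ν A T → ∀ a b : ℝ, a < b →
        |ν.real (Set.Ioc a b) - (gaussianReal 0 1).real (Set.Ioc a b)| ≤ C * (A + 1 / T) := by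
  obtain ⟨ρ, k, hk⟩ := exists_isSmoothingKernel
  set M := ∫ v, k v with hM
  have hM0 : 0 < M := hk.integral_pos
  refine ⟨2 ^ 23 / M + 1, by positivity, fun ν _ A T hA hT hν a b hab => ?_⟩
  rcases lt_or_ge 1 A with hA1 | hA1
  · have h1 : |ν.real (Set.Ioc a b) - (gaussianReal 0 1).real (Set.Ioc a b)| ≤ 1 := by
      rw [abs_le]
      constructor <;> linarith [measureReal_nonneg (μ := ν) (s := Set.Ioc a b),
        measureReal_nonneg (μ := gaussianReal 0 1) (s := Set.Ioc a b),
        measureReal_le_one (μ := ν) (s := Set.Ioc a b),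
        measureReal_le_one (μ := gaussianReal 0 1) (s := Set.Ioc a b)]
    have h2 : 1 ≤ A + 1 / T := by
      have : 0 < 1 / T := by positivity
      linarith
    have h3 : 0 < 2 ^ 23 / M := by positivity
    nlinarith
  -- Since ρ lives on [-2, 2], smoothing at scale τ sees frequencies up to 2τ = T.
  · have hτ : 0 < T / 2 := by linarith
    have hT2 : 2 * (T / 2) = T := by ring
    have h1 := hk.abs_measure_sub_smoothed_le (A := A) hτ hab hA1 (by rwa [hT2])
    have h2 := hk.abs_measure_sub_smoothed_le (A := 0) hτ hab (by norm_num)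
      (charFunNearGaussian_gaussianReal _)
    have h3 := hk.abs_smoothed_sub_smoothed_le (a := a) (b := b) hτ hA (by rwa [hT2])
    rw [← hM] at h1 h2
    have h4 : |M * (ν.real (Set.Ioc a b) - (gaussianReal 0 1).real (Set.Ioc a b))| ≤
        2 ^ 21 / (T / 2) + 2 ^ 21 / (T / 2) + 16 * A := by
      rw [abs_le] at h1 h2 h3 ⊢
      constructor <;> linarith [h1.1, h1.2, h2.1, h2.2, h3.1, h3.2]
    rw [abs_mul, abs_of_pos hM0] at h4
    have h5 : 2 ^ 21 / (T / 2) + 2 ^ 21 / (T / 2) + 16 * A ≤ 2 ^ 23 * (A + 1 / T) := by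
      have : 2 ^ 21 / (T / 2) + 2 ^ 21 / (T / 2) = 2 ^ 23 * (1 / T) := by
        field_simp
        ring
      rw [this]
      nlinarith
    have h6 : |ν.real (Set.Ioc a b) - (gaussianReal 0 1).real (Set.Ioc a b)| ≤
        2 ^ 23 / M * (A + 1 / T) := by
      rw [div_mul_eq_mul_div, le_div_iff₀ hM0]
      linarith
    have h7 : 0 ≤ A + 1 / T := by positivity
    nlinarith

/-! ### Exponential integrals and tilting -/

theorem integral_exp_neg_mul_eq_integral_measure_Ioc (ν : Measure ℝ) [IsProbabilityMeasure ν]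
    {z : ℝ} (hz : 0 < z) :
    ∫ y in Set.Ioi 0, Real.exp (-z * y) ∂ν =
      ∫ x in Set.Ioi 0, z * Real.exp (-z * x) * ν.real (Set.Ioc 0 x) := by
  have hexp : IntegrableOn (fun x : ℝ => z * Real.exp (-z * x)) (Set.Ioi 0) :=
    (integrableOn_exp_mul_Ioi (neg_lt_zero.2 hz) 0).const_mul z
  have hmeas : MeasurableSet {p : ℝ × ℝ | 0 < p.2 ∧ p.2 ≤ p.1} :=
    (measurableSet_lt measurable_const measurable_snd).inter
      (measurableSet_le measurable_snd measurable_fst)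
  have hind : ∀ x y : ℝ, (Set.Ioc 0 x).indicator (1 : ℝ → ℝ) y =
      {p : ℝ × ℝ | 0 < p.2 ∧ p.2 ≤ p.1}.indicator 1 (x, y) := fun x y => by
    simp [Set.indicator_apply]
  have hint : Integrable (Function.uncurry fun x y : ℝ =>
      z * Real.exp (-z * x) * (Set.Ioc 0 x).indicator (1 : ℝ → ℝ) y)
      ((volume.restrict (Set.Ioi 0)).prod ν) := by
    refine Integrable.mono' (hexp.integrable.comp_fst ν) ?_ (ae_of_all _ fun p => ?_)
    · simp only [hind]
      have h1 : Measurable ({p : ℝ × ℝ | 0 < p.2 ∧ p.2 ≤ p.1}.indicator (1 : ℝ × ℝ → ℝ)) :=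
        measurable_one.indicator hmeas
      exact (by fun_prop : Measurable _).aestronglyMeasurable
    · simp only [Function.uncurry]
      rw [norm_mul, Real.norm_eq_abs, abs_of_pos (by positivity)]
      refine mul_le_of_le_one_right (by positivity) ?_
      by_cases h : p.2 ∈ Set.Ioc 0 p.1 <;> simp [h]
  have h1 : ∀ x : ℝ, z * Real.exp (-z * x) * ν.real (Set.Ioc 0 x) =
      ∫ y, z * Real.exp (-z * x) * (Set.Ioc 0 x).indicator (1 : ℝ → ℝ) y ∂ν := fun x => by
    rw [integral_const_mul, integral_indicator_one measurableSet_Ioc]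
  simp only [h1]
  rw [integral_integral_swap hint, ← integral_indicator measurableSet_Ioi]
  refine integral_congr_ae (ae_of_all _ fun y => ?_)
  simp only [Set.indicator_apply, Set.mem_Ioi]
  split_ifs with hy
  · have h2 : ∀ x : ℝ, z * Real.exp (-z * x) * (if y ∈ Set.Ioc 0 x then (1 : ℝ → ℝ) y else 0) =
        (Set.Ici y).indicator (fun x => z * Real.exp (-z * x)) x := fun x => by
      simp [Set.indicator_apply, hy]
    simp only [h2]
    rw [setIntegral_indicator measurableSet_Ici,
      show Set.Ioi (0 : ℝ) ∩ Set.Ici y = Set.Ici y from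
        Set.inter_eq_right.2 fun x hx => lt_of_lt_of_le hy hx,
      integral_Ici_eq_integral_Ioi, integral_const_mul, integral_exp_mul_Ioi (neg_lt_zero.2 hz)]
    field_simp
  · simp [hy]

/-- For z > 0 each integral averages the masses of (0, x] against the probability density z e^{-zx},
so a uniform bound survives. For z = 0 that density is lost, and one lets x tend to infinity
instead. -/
theorem abs_integral_exp_neg_sub_le {ν ν' : Measure ℝ} [IsProbabilityMeasure ν]
    [IsProbabilityMeasure ν'] {z D : ℝ} (hz : 0 ≤ z)
    (hD : ∀ x, 0 < x → |ν.real (Set.Ioc 0 x) - ν'.real (Set.Ioc 0 x)| ≤ D) :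
    |∫ y in Set.Ioi 0, Real.exp (-z * y) ∂ν - ∫ y in Set.Ioi 0, Real.exp (-z * y) ∂ν'| ≤ D := by
  rcases hz.eq_or_lt with rfl | hz
  · have hlim : ∀ m : Measure ℝ, IsProbabilityMeasure m → Filter.Tendsto
        (fun n : ℕ => m.real (Set.Ioc (0 : ℝ) n)) Filter.atTop (nhds (m.real (Set.Ioi 0))) := by
      intro m hm
      have hU : ⋃ n : ℕ, Set.Ioc (0 : ℝ) n = Set.Ioi 0 :=
        Set.iUnion_Ioc_eq_Ioi_self_iff.2 fun x _ => exists_nat_ge x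
      have hmono : Monotone fun n : ℕ => Set.Ioc (0 : ℝ) n := fun a b hab =>
        Set.Ioc_subset_Ioc_right (by exact_mod_cast hab)
      have h1 := tendsto_measure_iUnion_atTop (μ := m) hmono
      rw [hU] at h1
      exact (ENNReal.tendsto_toReal (measure_ne_top m _)).comp h1
    simp only [neg_zero, zero_mul, Real.exp_zero, integral_const, smul_eq_mul, mul_one,
      measureReal_restrict_apply_univ]
    refine le_of_tendsto ((hlim ν inferInstance).sub (hlim ν' inferInstance)).abs ?_
    filter_upwards [Filter.eventually_gt_atTop 0] with n hn
    exact hD n (by exact_mod_cast hn)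
  · rw [integral_exp_neg_mul_eq_integral_measure_Ioc ν hz,
      integral_exp_neg_mul_eq_integral_measure_Ioc ν' hz]
    have hexp : IntegrableOn (fun x : ℝ => z * Real.exp (-z * x)) (Set.Ioi 0) :=
      (integrableOn_exp_mul_Ioi (neg_lt_zero.2 hz) 0).const_mul z
    have hint : ∀ m : Measure ℝ, IsProbabilityMeasure m → IntegrableOn
        (fun x : ℝ => z * Real.exp (-z * x) * m.real (Set.Ioc 0 x)) (Set.Ioi 0) := by
      intro m hm
      refine Integrable.mono' hexp ?_ (ae_of_all _ fun x => ?_)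
      · have hmono : Monotone fun x : ℝ => m.real (Set.Ioc 0 x) := fun a b hab =>
          measureReal_mono (Set.Ioc_subset_Ioc_right hab)
        have := hmono.measurable
        exact (by fun_prop : Measurable _).aestronglyMeasurable
      · rw [norm_mul, Real.norm_eq_abs, Real.norm_eq_abs, abs_of_pos (by positivity),
          abs_of_nonneg measureReal_nonneg]
        exact mul_le_of_le_one_right (by positivity) measureReal_le_one
    rw [← integral_sub (hint ν inferInstance) (hint ν' inferInstance), ← Real.norm_eq_abs]
    refine (norm_integral_le_of_norm_le (hexp.integrable.mul_const D) ?_).trans ?_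
    · filter_upwards [ae_restrict_mem measurableSet_Ioi] with x hx
      rw [← mul_sub, norm_mul, Real.norm_eq_abs, Real.norm_eq_abs, abs_of_pos (by positivity)]
      exact mul_le_mul_of_nonneg_left (hD x hx) (by positivity)
    · rw [integral_mul_const, integral_const_mul, integral_exp_mul_Ioi (neg_lt_zero.2 hz)]
      simp only [mul_zero, Real.exp_zero]
      rw [show z * (-1 / -z) * D = D by field_simp]

/-- The law of `W - z` under the exponential tilt of `μ` by `z * W`. -/
noncomputable def tiltedLaw {Ω : Type*} [MeasurableSpace Ω] (μ : Measure Ω) (W : Ω → ℝ) (z : ℝ) :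
    Measure ℝ :=
  (μ.tilted (z * W ·)).map (fun ω => W ω - z)

section Tilted

variable {Ω : Type*} [MeasurableSpace Ω] {μ : Measure Ω} {W : Ω → ℝ} {z : ℝ}

theorem isProbabilityMeasure_tiltedLaw [IsProbabilityMeasure μ] (hW : Measurable W)
    (hz : Integrable (fun ω => Real.exp (z * W ω)) μ) :
    IsProbabilityMeasure (tiltedLaw μ W z) := by
  have := isProbabilityMeasure_tilted hz
  exact Measure.isProbabilityMeasure_map (by fun_prop)

theorem charFun_tiltedLaw (hW : Measurable W) (t : ℝ) :
    charFun (tiltedLaw μ W z) t =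
      complexMGF W μ (z + t * Complex.I) / mgf W μ z * Complex.exp (-(t * z) * Complex.I) := by
  rw [charFun_apply_real, tiltedLaw, integral_map (by fun_prop) (by fun_prop),
    integral_tilted_mul_eq_mgf, complexMGF, div_mul_eq_mul_div, ← integral_mul_const,
    ← integral_div]
  refine integral_congr_ae (ae_of_all _ fun ω => ?_)
  simp only [Complex.real_smul]
  push_cast
  rw [div_mul_eq_mul_div, ← Complex.exp_add, ← Complex.exp_add]
  congr 2
  ring

theorem measureReal_lt_eq_tiltedLaw [IsProbabilityMeasure μ] (hW : Measurable W)
    (hz : Integrable (fun ω => Real.exp (z * W ω)) μ) :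
    μ.real {ω | z < W ω} =
      mgf W μ z * Real.exp (-z ^ 2) *
        ∫ y in Set.Ioi 0, Real.exp (-z * y) ∂(tiltedLaw μ W z) := by
  have hs : MeasurableSet {ω | z < W ω} := measurableSet_lt measurable_const hW
  rw [tiltedLaw, setIntegral_map measurableSet_Ioi (by fun_prop) (by fun_prop)]
  have h1 : (fun ω => W ω - z) ⁻¹' Set.Ioi 0 = {ω | z < W ω} := by
    ext ω; simp
  have hm : 0 < mgf W μ z := mgf_pos hz
  rw [h1, setIntegral_tilted_mul_eq_mgf' _ hs]
  have h2 : ∀ ω, (Real.exp (z * W ω) / mgf W μ z) • Real.exp (-z * (W ω - z)) =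
      Real.exp (z ^ 2) / mgf W μ z := fun ω => by
    rw [smul_eq_mul, div_mul_eq_mul_div, ← Real.exp_add]
    congr 2
    ring
  simp only [h2, integral_const, smul_eq_mul, measureReal_restrict_apply_univ]
  rw [Real.exp_neg]
  have := Real.exp_pos (z ^ 2)
  field_simp

end Tilted

/-- The Gaussian is fixed by tilting and recentering, so its tail has the same representation as
that of W, and the two become comparable. -/
theorem tiltedLaw_gaussianReal (z : ℝ) :
    tiltedLaw (gaussianReal 0 1) id z = gaussianReal 0 1 := by
  have hi : Integrable (fun ω => Real.exp (z * id ω)) (gaussianReal 0 1) :=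
    integrable_exp_mul_gaussianReal z
  have := isProbabilityMeasure_tiltedLaw (μ := gaussianReal 0 1) measurable_id hi
  refine Measure.ext_of_charFun ?_
  ext t
  rw [charFun_tiltedLaw measurable_id, ← complexMGF_ofReal, complexMGF_id_gaussianReal,
    complexMGF_id_gaussianReal, charFun_gaussianReal, ← Complex.exp_sub, ← Complex.exp_add]
  congr 1
  push_cast
  ring_nf
  rw [Complex.I_sq]
  ring

/-! ### The Gaussian tail -/

theorem one_sub_stdNormalCDF (z : ℝ) :
    1 - stdNormalCDF z = (gaussianReal 0 1).real (Set.Ioi z) := by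
  rw [stdNormalCDF, cdf_eq_real, ← Set.compl_Iic, probReal_compl_eq_one_sub measurableSet_Iic]

theorem one_sub_stdNormalCDF_eq_integral (z : ℝ) :
    1 - stdNormalCDF z =
      Real.exp (-z ^ 2 / 2) * ∫ y in Set.Ioi 0, Real.exp (-z * y) ∂(gaussianReal 0 1) := by
  have h := measureReal_lt_eq_tiltedLaw (μ := gaussianReal 0 1) (W := id) (z := z) measurable_id
    (integrable_exp_mul_gaussianReal z)
  rw [tiltedLaw_gaussianReal, mgf_id_gaussianReal] at h
  rw [one_sub_stdNormalCDF]
  change (gaussianReal 0 1).real (Set.Ioi z) = _ at h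
  rw [h, ← Real.exp_add]
  congr 2
  simp
  ring

/-- On (z, z + 1/(1 + z)] one has x² ≤ z² + 3, so the density loses only a constant factor; that
piece alone carries enough mass. -/
theorem exp_neg_sq_half_le (z : ℝ) (hz : 0 ≤ z) :
    Real.exp (-z ^ 2 / 2) ≤ 16 * (1 + z) * (1 - stdNormalCDF z) := by
  set w := z + 1 / (1 + z) with hw
  have hzw : z ≤ w := by
    have : 0 < 1 / (1 + z) := by positivity
    linarith
  have h1 : (gaussianReal 0 1).real (Set.Ioc z w) ≤ 1 - stdNormalCDF z := by
    rw [one_sub_stdNormalCDF]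
    exact measureReal_mono Set.Ioc_subset_Ioi_self
  have h2 : (gaussianReal 0 1).real (Set.Ioc z w) = ∫ x in Set.Ioc z w, gaussianPDFReal 0 1 x := by
    rw [measureReal_def, gaussianReal_apply_eq_integral _ one_ne_zero, ENNReal.toReal_ofReal]
    exact integral_nonneg fun x => gaussianPDFReal_nonneg _ _ _
  have h3 : ∫ x in Set.Ioc z w, Real.exp (-z ^ 2 / 2) / 16 ≤
      ∫ x in Set.Ioc z w, gaussianPDFReal 0 1 x := by
    refine setIntegral_mono_on (by simp) (integrable_gaussianPDFReal _ _).integrableOn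
      measurableSet_Ioc fun x hx => ?_
    have hx2 : x ^ 2 ≤ z ^ 2 + 3 := by
      have h4 : x ≤ w := hx.2
      have h5 : w ^ 2 ≤ z ^ 2 + 3 := by
        have h6 : z * (1 / (1 + z)) ≤ 1 := by
          rw [mul_one_div, div_le_one (by positivity)]
          linarith
        have h7 : 1 / (1 + z) ≤ 1 := by
          rw [div_le_one (by positivity)]
          linarith
        have h8 : 0 ≤ 1 / (1 + z) := by positivity
        rw [hw]
        nlinarith
      have h6 : z < x := hx.1
      nlinarith
    have h4 : Real.exp (-z ^ 2 / 2) * Real.exp (-(3 / 2)) ≤ Real.exp (-(x - 0) ^ 2 / (2 * 1)) := by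
      rw [← Real.exp_add, Real.exp_le_exp]
      linarith
    have h5 : √(2 * Real.pi * (1 : NNReal)) ≤ 3 := by
      rw [Real.sqrt_le_left (by norm_num)]
      norm_num
      linarith [Real.pi_lt_d2]
    have h6 : (0 : ℝ) < √(2 * Real.pi * (1 : NNReal)) := by
      have := Real.pi_pos
      simp [this]
    have h7 : (1 : ℝ) / 5 ≤ Real.exp (-(3 / 2)) := by
      rw [Real.exp_neg, ← one_div, one_div_le_one_div (by norm_num) (Real.exp_pos _)]
      have h8 : Real.exp (3 / 2) ^ 2 = Real.exp 1 ^ 3 := by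
        rw [← Real.exp_nat_mul, ← Real.exp_nat_mul]
        norm_num
      have h9 : Real.exp 1 ^ 3 ≤ 2.72 ^ 3 := by
        have := Real.exp_one_lt_d9
        gcongr
        linarith
      nlinarith [Real.exp_pos (3 / 2)]
    rw [gaussianPDFReal]
    have h8 : (1 : ℝ) / 3 ≤ (√(2 * Real.pi * (1 : NNReal)))⁻¹ := by
      rw [← one_div, one_div_le_one_div (by norm_num) h6]
      exact h5
    have hE := Real.exp_pos (-z ^ 2 / 2)
    calc Real.exp (-z ^ 2 / 2) / 16 ≤ 1 / 3 * (Real.exp (-z ^ 2 / 2) * (1 / 5)) := by linarith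
      _ ≤ 1 / 3 * (Real.exp (-z ^ 2 / 2) * Real.exp (-(3 / 2))) := by gcongr
      _ ≤ (√(2 * Real.pi * (1 : NNReal)))⁻¹ * Real.exp (-(x - 0) ^ 2 / (2 * 1)) := by gcongr
      _ = _ := by simp
  have h4 : ∫ x in Set.Ioc z w, Real.exp (-z ^ 2 / 2) / 16 =
      1 / (1 + z) * (Real.exp (-z ^ 2 / 2) / 16) := by
    rw [setIntegral_const, Real.volume_real_Ioc_of_le hzw, hw, smul_eq_mul]
    ring
  have h5 : 1 / (1 + z) * (Real.exp (-z ^ 2 / 2) / 16) ≤ 1 - stdNormalCDF z := by linarith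
  rw [one_div, inv_mul_le_iff₀ (by positivity)] at h5
  linarith

theorem one_sub_stdNormalCDF_pos {z : ℝ} (hz : 0 ≤ z) : 0 < 1 - stdNormalCDF z := by
  have h1 := exp_neg_sq_half_le z hz
  have h2 := Real.exp_pos (-z ^ 2 / 2)
  by_contra h3
  have : 16 * (1 + z) * (1 - stdNormalCDF z) ≤ 0 :=
    mul_nonpos_of_nonneg_of_nonpos (by positivity) (not_lt.1 h3)
  linarith

/-! ### Moderate deviations from the logarithm of the moment generating function -/

theorem Complex.norm_exp_sub_one_le_mul_exp (w : ℂ) :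
    ‖Complex.exp w - 1‖ ≤ ‖w‖ * Real.exp ‖w‖ := by
  simpa using Complex.norm_exp_sub_sum_le_norm_mul_exp w 1

/-- `f` is a logarithm of the moment generating function of `W` on the disc of radius `R`, and is
cubically close to `s ^ 2 / 2` there. -/
structure IsLogMGF {Ω : Type*} [MeasurableSpace Ω] (μ : Measure Ω) (W : Ω → ℝ) (R κ : ℝ)
    (f : ℂ → ℂ) : Prop where
  integrable : ∀ t : ℝ, |t| < R → Integrable (fun ω => Real.exp (t * W ω)) μ
  zero : f 0 = 0
  differentiableOn : DifferentiableOn ℂ f (Metric.ball 0 R)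
  exp_eq : ∀ s ∈ Metric.ball (0 : ℂ) R, Complex.exp (f s) = complexMGF W μ s
  deriv_sub_le : ∀ s ∈ Metric.ball (0 : ℂ) R, ‖deriv f s - s‖ ≤ κ * ‖s‖ ^ 2

namespace IsLogMGF

variable {Ω : Type*} [MeasurableSpace Ω] {μ : Measure Ω} {W : Ω → ℝ}
  {R κ z : ℝ} {f : ℂ → ℂ} (hf : IsLogMGF μ W R κ f)
include hf

theorem norm_sub_le (hκ : 0 ≤ κ) {r : ℝ} (hr : r < R) {x y : ℂ} (hx : ‖x‖ ≤ r) (hy : ‖y‖ ≤ r) :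
    ‖(f y - y ^ 2 / 2) - (f x - x ^ 2 / 2)‖ ≤ κ * r ^ 2 * ‖y - x‖ := by
  have hsub : Metric.closedBall (0 : ℂ) r ⊆ Metric.ball 0 R := Metric.closedBall_subset_ball hr
  have hd : ∀ s ∈ Metric.closedBall (0 : ℂ) r,
      HasDerivAt (fun s => f s - s ^ 2 / 2) (deriv f s - s) s := fun s hs => by
    have h1 := (hf.differentiableOn.differentiableAt
      (Metric.isOpen_ball.mem_nhds (hsub hs))).hasDerivAt
    have h2 := ((hasDerivAt_id s).pow 2).div_const 2
    have h3 := h1.sub h2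
    have h4 : (deriv f s - ((2 : ℕ) : ℂ) * id s ^ (2 - 1) * 1 / 2) = deriv f s - s := by
      simp
    rw [h4] at h3
    exact h3
  refine (convex_closedBall (0 : ℂ) r).norm_image_sub_le_of_norm_deriv_le (𝕜 := ℂ)
    (f := fun s => f s - s ^ 2 / 2) (fun s hs => (hd s hs).differentiableAt) (fun s hs => ?_)
    (by simpa using hx) (by simpa using hy)
  rw [(hd s hs).deriv]
  refine (hf.deriv_sub_le s (hsub hs)).trans ?_
  have : ‖s‖ ≤ r := by simpa using hs
  gcongr

/-- The quadratic part of f contributes (z + it)²/2 - z²/2 - itz = -t²/2 exactly; the increment of f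
- s²/2 is the whole error. -/
theorem charFun_tiltedLaw_eq (hW : Measurable W) (hz : 0 ≤ z) {t : ℝ} (ht : z + |t| < R) :
    charFun (tiltedLaw μ W z) t = Real.exp (-t ^ 2 / 2) *
      Complex.exp ((f (z + t * Complex.I) - (z + t * Complex.I) ^ 2 / 2) -
        (f z - (z : ℂ) ^ 2 / 2)) := by
  have hz' : (z : ℂ) ∈ Metric.ball (0 : ℂ) R := by
    simp [abs_of_nonneg hz]
    linarith [abs_nonneg t]
  have hzt : (z + t * Complex.I : ℂ) ∈ Metric.ball (0 : ℂ) R := by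
    rw [mem_ball_zero_iff]
    refine (norm_add_le _ _).trans_lt ?_
    simpa [abs_of_nonneg hz] using ht
  rw [charFun_tiltedLaw hW, ← complexMGF_ofReal, ← hf.exp_eq _ hz', ← hf.exp_eq _ hzt,
    ← Complex.exp_sub, ← Complex.exp_add, Complex.ofReal_exp, ← Complex.exp_add]
  congr 1
  push_cast
  ring_nf
  rw [Complex.I_sq]
  ring

/-- The frequency range forces |t| ≤ R/2, which keeps z + it in the disc, and 16κ|t| ≤ 1, which
makes the cubic error at most t²/8. The exponent error is then at most t²/4 + 8, leaving e^{-t²/4}: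
one half absorbs z² + t², the other is the decay required. -/
theorem charFunNearGaussian (hW : Measurable W) (hκ : 0 ≤ κ) (hκ1 : κ ≤ 1) (hR : 0 < R)
    (hz : 0 ≤ z) (hzR : z ≤ R / 4) (hκz : κ * z ^ 3 ≤ 1) :
    CharFunNearGaussian (tiltedLaw μ W z) (16 * Real.exp 8 * κ * (1 + z ^ 2))
      (2 / R + 16 * κ)⁻¹ := by
  intro t ht
  have hpos : 0 < 2 / R + 16 * κ := by positivity
  have ht1 : |t| * (2 / R + 16 * κ) ≤ 1 := by
    rwa [← le_div_iff₀ hpos, one_div]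
  have htR : |t| ≤ R / 2 := by
    have h1 : |t| * (2 / R) ≤ 1 := by nlinarith [abs_nonneg t, mul_nonneg (abs_nonneg t) hκ]
    rw [mul_div_assoc', div_le_one hR] at h1
    linarith
  have htκ : 16 * κ * |t| ≤ 1 := by
    have h1 : 0 ≤ |t| * (2 / R) := by positivity
    nlinarith
  have hlt : z + |t| < R := by linarith
  rw [hf.charFun_tiltedLaw_eq hW hz hlt]
  set w := (f (z + t * Complex.I) - (z + t * Complex.I) ^ 2 / 2) - (f z - (z : ℂ) ^ 2 / 2) with hw
  have ht0 := abs_nonneg t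
  have hwn : ‖w‖ ≤ κ * (z + |t|) ^ 2 * |t| := by
    have := hf.norm_sub_le hκ hlt (x := z) (y := z + t * Complex.I)
      (by simp [abs_of_nonneg hz]) ((norm_add_le _ _).trans (by simp [abs_of_nonneg hz]))
    simpa using this
  have hw2 : ‖w‖ ≤ 2 * κ * |t| * (z ^ 2 + t ^ 2) := by
    refine hwn.trans ?_
    have h1 : (z + |t|) ^ 2 ≤ 2 * (z ^ 2 + t ^ 2) := by
      rw [← sq_abs t]
      nlinarith [sq_nonneg (z - |t|)]
    calc κ * (z + |t|) ^ 2 * |t| ≤ κ * (2 * (z ^ 2 + t ^ 2)) * |t| := by gcongr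
      _ = _ := by ring
  have hκz2 : κ * z ^ 2 ≤ 1 := by
    rcases le_total z 1 with h | h
    · have : z ^ 2 ≤ 1 := pow_le_one₀ hz h
      nlinarith [sq_nonneg z]
    · have : z ^ 2 ≤ z ^ 3 := pow_le_pow_right₀ h (by norm_num)
      nlinarith
  have hw3 : ‖w‖ ≤ t ^ 2 / 4 + 8 := by
    have h1 : 2 * κ * |t| * t ^ 2 ≤ t ^ 2 / 8 := by nlinarith [sq_nonneg t]
    have h2 : 2 * (κ * z ^ 2) * |t| ≤ t ^ 2 / 8 + 8 := by
      have h3 : 2 * (κ * z ^ 2) * |t| ≤ 2 * 1 * |t| := by gcongr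
      rw [← sq_abs t]
      nlinarith [sq_nonneg (|t| - 8)]
    linarith
  have hfac : (Real.exp (-t ^ 2 / 2) : ℂ) * Complex.exp w - Real.exp (-t ^ 2 / 2) =
      (Real.exp (-t ^ 2 / 2) : ℂ) * (Complex.exp w - 1) := by ring
  rw [hfac, norm_mul, Complex.norm_real, Real.norm_eq_abs, abs_of_pos (Real.exp_pos _)]
  have h8 : (z ^ 2 + t ^ 2) * Real.exp (-t ^ 2 / 8) ≤ 8 * (1 + z ^ 2) := by
    have h9 : Real.exp (-t ^ 2 / 8) = (Real.exp (t ^ 2 / 8))⁻¹ := by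
      rw [← Real.exp_neg]; congr 1; ring
    rw [h9, ← div_eq_mul_inv, div_le_iff₀ (Real.exp_pos _)]
    have h10 := Real.add_one_le_exp (t ^ 2 / 8)
    nlinarith [sq_nonneg z, sq_nonneg t]
  calc Real.exp (-t ^ 2 / 2) * ‖Complex.exp w - 1‖
      ≤ Real.exp (-t ^ 2 / 2) * (‖w‖ * Real.exp ‖w‖) := by
        gcongr
        exact Complex.norm_exp_sub_one_le_mul_exp w
    _ ≤ Real.exp (-t ^ 2 / 2) *
        (2 * κ * |t| * (z ^ 2 + t ^ 2) * Real.exp (t ^ 2 / 4 + 8)) := by gcongr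
    _ = 2 * Real.exp 8 * κ * |t| * ((z ^ 2 + t ^ 2) * Real.exp (-t ^ 2 / 8)) *
        Real.exp (-t ^ 2 / 8) := by
        have h11 : Real.exp (-t ^ 2 / 2) * Real.exp (t ^ 2 / 4 + 8) =
            Real.exp 8 * Real.exp (-t ^ 2 / 8) * Real.exp (-t ^ 2 / 8) := by
          rw [← Real.exp_add, ← Real.exp_add, ← Real.exp_add]
          congr 1
          ring
        linear_combination (2 * κ * |t| * (z ^ 2 + t ^ 2)) * h11
    _ ≤ 2 * Real.exp 8 * κ * |t| * (8 * (1 + z ^ 2)) * Real.exp (-t ^ 2 / 8) := by gcongr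
    _ = _ := by ring

theorem abs_mgf_mul_exp_sub_one_le (hκ : 0 ≤ κ) (hR : 0 < R)
    (hz : 0 ≤ z) (hzR : z ≤ R / 4) (hκz : κ * z ^ 3 ≤ 1) :
    |mgf W μ z * Real.exp (-z ^ 2 / 2) - 1| ≤ 3 * (κ * z ^ 3) := by
  have hz' : (z : ℂ) ∈ Metric.ball (0 : ℂ) R := by
    simp [abs_of_nonneg hz]
    linarith
  have h1 : ((mgf W μ z * Real.exp (-z ^ 2 / 2) : ℝ) : ℂ) =
      Complex.exp (f z - (z : ℂ) ^ 2 / 2) := by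
    rw [Complex.exp_sub, hf.exp_eq _ hz', complexMGF_ofReal]
    push_cast
    rw [neg_div, Complex.exp_neg, ← div_eq_mul_inv]
  have h2 : ‖f z - (z : ℂ) ^ 2 / 2‖ ≤ κ * z ^ 3 := by
    have := hf.norm_sub_le hκ (r := z) (by linarith) (x := 0) (y := z) (by simpa using hz)
      (by simp [abs_of_nonneg hz])
    simp [hf.zero, abs_of_nonneg hz] at this
    linarith
  rw [← Real.norm_eq_abs, ← Complex.norm_real, Complex.ofReal_sub, h1, Complex.ofReal_one]
  refine (Complex.norm_exp_sub_one_le_mul_exp _).trans ?_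
  have h3 : Real.exp ‖f z - (z : ℂ) ^ 2 / 2‖ ≤ 3 := by
    refine (Real.exp_le_exp.2 (h2.trans hκz)).trans ?_
    linarith [Real.exp_one_lt_d9]
  calc _ ≤ κ * z ^ 3 * 3 := by gcongr
    _ = _ := by ring

end IsLogMGF

/-- **Cramér-type moderate deviations** from a logarithm of the moment generating function. -/
theorem exists_moderate_deviation_of_isLogMGF : ∃ C : ℝ, 0 < C ∧
    ∀ (Ω : Type*) [MeasurableSpace Ω] (μ : Measure Ω) [IsProbabilityMeasure μ] (W : Ω → ℝ)
      (R κ z : ℝ) (f : ℂ → ℂ), Measurable W → IsLogMGF μ W R κ f → 0 < R → 0 ≤ κ → κ ≤ 1 →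
      0 ≤ z → z ≤ R / 4 → κ * z ^ 3 ≤ 1 →
      |μ.real {ω | z < W ω} / (1 - stdNormalCDF z) - 1| ≤ C * (κ + 1 / R) * (1 + z ^ 3) := by
  obtain ⟨C, hC, hsm⟩ := exists_interval_prob_near_gaussian
  refine ⟨8192 * Real.exp 8 * C + 3, by positivity, ?_⟩
  intro Ω _ μ _ W R κ z f hW hf hR hκ hκ1 hz hzR hκz
  have hint : Integrable (fun ω => Real.exp (z * W ω)) μ :=
    hf.integrable z (by rw [abs_of_nonneg hz]; linarith)
  have := isProbabilityMeasure_tiltedLaw hW hint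
  set D := C * (16 * Real.exp 8 * κ * (1 + z ^ 2) + 1 / (2 / R + 16 * κ)⁻¹) with hD
  have hDb := abs_integral_exp_neg_sub_le (ν := tiltedLaw μ W z) (ν' := gaussianReal 0 1) hz
    (D := D) fun x hx => hsm _ _ _ (by positivity) (by positivity)
      (hf.charFunNearGaussian hW hκ hκ1 hR hz hzR hκz) 0 x hx
  have hP := measureReal_lt_eq_tiltedLaw hW hint
  have hΦ := one_sub_stdNormalCDF_eq_integral z
  have hΦ0 := one_sub_stdNormalCDF_pos hz
  have hmill := exp_neg_sq_half_le z hz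
  have hG := hf.abs_mgf_mul_exp_sub_one_le hκ hR hz hzR hκz
  set Φc := 1 - stdNormalCDF z with hΦc
  set I := ∫ y in Set.Ioi 0, Real.exp (-z * y) ∂(tiltedLaw μ W z) with hI
  set J := ∫ y in Set.Ioi 0, Real.exp (-z * y) ∂(gaussianReal 0 1) with hJ
  set G := mgf W μ z * Real.exp (-z ^ 2 / 2) with hGdef
  have hexp : Real.exp (-z ^ 2) = Real.exp (-z ^ 2 / 2) * Real.exp (-z ^ 2 / 2) := by
    rw [← Real.exp_add]; congr 1; ring
  -- The first term is the error of the tilted law, the second that of the generating function at z.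
  -- The Mills bound trades the factor e^{-z²/2} in the first for (1 + z)Φc, so both errors are
  -- relative to Φc.
  have hPG : μ.real {ω | z < W ω} - Φc =
      G * Real.exp (-z ^ 2 / 2) * (I - J) + (G - 1) * Φc := by
    rw [hP, hΦ, hexp, hGdef]
    ring
  have hG4 : |G| ≤ 4 := by
    have h1 := abs_le.1 hG
    rw [abs_le]
    constructor <;> linarith [h1.1, h1.2]
  clear_value G
  have hE1 : 1 ≤ Real.exp 8 := Real.one_le_exp (by norm_num)
  have hD' : D ≤ 32 * Real.exp 8 * C * ((κ + 1 / R) * (1 + z ^ 2)) := by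
    have h0 : 0 < 1 / R := by positivity
    have h1 : 16 * Real.exp 8 * κ * (1 + z ^ 2) + 1 / (2 / R + 16 * κ)⁻¹ ≤
        32 * Real.exp 8 * ((κ + 1 / R) * (1 + z ^ 2)) := by
      rw [one_div, inv_inv, show 2 / R = 2 * (1 / R) by ring]
      have h2 : (16 * κ + 2 * (1 / R)) * 1 ≤
          (16 * κ + 32 * (1 / R)) * (Real.exp 8 * (1 + z ^ 2)) := by
        gcongr
        · norm_num
        · nlinarith [sq_nonneg z]
      linarith
    rw [hD]
    calc _ ≤ C * (32 * Real.exp 8 * ((κ + 1 / R) * (1 + z ^ 2))) := by gcongr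
      _ = _ := by ring
  have hε : 0 ≤ κ + 1 / R := by positivity
  have hpoly : (1 + z) * (1 + z ^ 2) ≤ 4 * (1 + z ^ 3) := by
    nlinarith [mul_nonneg hz (sq_nonneg (z - 1)), sq_nonneg (z - 1), mul_nonneg hz (sq_nonneg z)]
  have hmain : |μ.real {ω | z < W ω} - Φc| ≤
      (8192 * Real.exp 8 * C + 3) * (κ + 1 / R) * (1 + z ^ 3) * Φc := by
    rw [hPG]
    refine (abs_add_le _ _).trans ?_
    rw [abs_mul, abs_mul, abs_mul, abs_of_pos (Real.exp_pos _), abs_of_pos hΦ0]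
    have h1 : |G| * Real.exp (-z ^ 2 / 2) * |I - J| ≤
        8192 * Real.exp 8 * C * ((κ + 1 / R) * (1 + z ^ 3)) * Φc := by
      calc |G| * Real.exp (-z ^ 2 / 2) * |I - J|
          ≤ 4 * (16 * (1 + z) * Φc) *
            (32 * Real.exp 8 * C * ((κ + 1 / R) * (1 + z ^ 2))) := by
            gcongr
            exact hDb.trans hD'
        _ = 2048 * Real.exp 8 * C * (κ + 1 / R) * Φc * ((1 + z) * (1 + z ^ 2)) := by ring
        _ ≤ 2048 * Real.exp 8 * C * (κ + 1 / R) * Φc * (4 * (1 + z ^ 3)) := by gcongr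
        _ = _ := by ring
    have h2 : |G - 1| * Φc ≤ 3 * ((κ + 1 / R) * (1 + z ^ 3)) * Φc := by
      gcongr
      refine hG.trans ?_
      gcongr
      · have : 0 < 1 / R := by positivity
        linarith
      · linarith
    linarith
  have hq : μ.real {ω | z < W ω} / Φc - 1 = (μ.real {ω | z < W ω} - Φc) / Φc := by
    field_simp
  rw [hq, abs_div, abs_of_pos hΦ0, div_le_iff₀ hΦ0]
  exact hmain

/-! ### Sums over permutations and Hoeffding's variance formula -/

section PermSums

variable {n : ℕ}

theorem card_mul_sum_perm_apply (g : Fin n → ℝ) (i : Fin n) :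
    (n : ℝ) * ∑ σ : Equiv.Perm (Fin n), g (σ i) = n.factorial * ∑ j, g j := by
  have h1 : ∀ k, ∑ σ : Equiv.Perm (Fin n), g (σ k) = ∑ σ : Equiv.Perm (Fin n), g (σ i) := by
    intro k
    rw [← Equiv.sum_comp (Equiv.mulRight (Equiv.swap i k))]
    simp
  have h2 : ∑ k, ∑ σ : Equiv.Perm (Fin n), g (σ k) = n.factorial * ∑ j, g j := by
    rw [Finset.sum_comm]
    simp only [Equiv.sum_comp]
    simp [Fintype.card_perm]
  rw [← h2]
  simp [h1]

theorem sum_perm_sum_apply (a : Fin n → Fin n → ℝ) :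
    (n : ℝ) * ∑ σ : Equiv.Perm (Fin n), ∑ i, a i (σ i) = n.factorial * ∑ i, ∑ j, a i j := by
  rw [Finset.sum_comm, Finset.mul_sum, Finset.mul_sum]
  exact Finset.sum_congr rfl fun i _ => card_mul_sum_perm_apply (a i) i

/-- For i ≠ k, symmetry lets σ k be replaced by σ l for any l ≠ i; summing over these l and using
that row k sums to 0 reduces to the diagonal case. Factors are cleared so that no division by n - 1
occurs. -/
theorem sum_perm_mul_apply {a : Fin n → Fin n → ℝ} (hrow : ∀ i, ∑ j, a i j = 0) (i k : Fin n) :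
    (n : ℝ) * (((n : ℝ) - 1) * ∑ σ : Equiv.Perm (Fin n), a i (σ i) * a k (σ k)) =
      n.factorial * ((if i = k then n * ∑ j, a i j * a k j else 0) - ∑ j, a i j * a k j) := by
  have hdiag := card_mul_sum_perm_apply (fun j => a i j * a k j) i
  split_ifs with hik
  · subst hik
    linear_combination ((n : ℝ) - 1) * hdiag
  · have h1 : ∀ l ∈ Finset.univ.erase i, ∑ σ : Equiv.Perm (Fin n), a i (σ i) * a k (σ l) =
        ∑ σ : Equiv.Perm (Fin n), a i (σ i) * a k (σ k) := by
      intro l hl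
      rw [← Equiv.sum_comp (Equiv.mulRight (Equiv.swap k l))]
      have hli : i ≠ l := (Finset.ne_of_mem_erase hl).symm
      simp [Equiv.swap_apply_of_ne_of_ne hik hli]
    have h2 : ((n : ℝ) - 1) * ∑ σ : Equiv.Perm (Fin n), a i (σ i) * a k (σ k) =
        -∑ σ : Equiv.Perm (Fin n), a i (σ i) * a k (σ i) := by
      have h3 : ∑ l ∈ Finset.univ.erase i, ∑ σ : Equiv.Perm (Fin n), a i (σ i) * a k (σ l) =
          ((n : ℝ) - 1) * ∑ σ : Equiv.Perm (Fin n), a i (σ i) * a k (σ k) := by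
        rw [Finset.sum_congr rfl h1, Finset.sum_const, Finset.card_erase_of_mem (Finset.mem_univ i),
          Finset.card_univ, Fintype.card_fin, nsmul_eq_mul, Nat.cast_sub (Fin.pos i), Nat.cast_one]
      rw [← h3, Finset.sum_comm, ← Finset.sum_neg_distrib]
      refine Finset.sum_congr rfl fun σ _ => ?_
      rw [← Finset.mul_sum]
      have h4 : ∑ l ∈ Finset.univ.erase i, a k (σ l) + a k (σ i) = 0 := by
        rw [Finset.sum_erase_add _ _ (Finset.mem_univ i), Equiv.sum_comp σ (a k), hrow]
      linear_combination a i (σ i) * h4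
    rw [h2]
    linear_combination -hdiag

/-- **Hoeffding's variance formula** for a doubly centered array. -/
theorem sum_perm_sq_sum_apply {a : Fin n → Fin n → ℝ} (hcol : ∀ j, ∑ i, a i j = 0)
    (hrow : ∀ i, ∑ j, a i j = 0) :
    1 / (n.factorial : ℝ) * ∑ σ : Equiv.Perm (Fin n), (∑ i, a i (σ i)) ^ 2 =
      1 / ((n : ℝ) - 1) * ∑ i, ∑ j, a i j ^ 2 := by
  have hfac : (n.factorial : ℝ) ≠ 0 := by exact_mod_cast n.factorial_ne_zero
  have h1 : ((n : ℝ) - 1) * (n * ∑ σ : Equiv.Perm (Fin n), (∑ i, a i (σ i)) ^ 2) =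
      n * (n.factorial * ∑ i, ∑ j, a i j ^ 2) := by
    have h2 : ∑ σ : Equiv.Perm (Fin n), (∑ i, a i (σ i)) ^ 2 =
        ∑ i, ∑ k, ∑ σ : Equiv.Perm (Fin n), a i (σ i) * a k (σ k) := by
      simp only [pow_two, Finset.sum_mul_sum]
      rw [Finset.sum_comm]
      exact Finset.sum_congr rfl fun i _ => Finset.sum_comm
    have h3 : ∑ i, ∑ k, (n.factorial : ℝ) *
        ((if i = k then n * ∑ j, a i j * a k j else 0) - ∑ j, a i j * a k j) =
        n * (n.factorial * ∑ i, ∑ j, a i j ^ 2) := by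
      have h4 : ∑ i, ∑ k, ∑ j, a i j * a k j = 0 := by
        have : ∀ i, ∑ k, ∑ j, a i j * a k j = 0 := fun i => by
          rw [Finset.sum_comm]
          simp [← Finset.mul_sum, hcol]
        simp [this]
      simp only [← Finset.mul_sum, Finset.sum_sub_distrib, h4, sub_zero]
      simp [Finset.mul_sum, pow_two]
      refine Finset.sum_congr rfl fun i _ => Finset.sum_congr rfl fun j _ => by ring
    rw [← h3, h2, mul_left_comm, Finset.mul_sum, Finset.mul_sum]
    refine Finset.sum_congr rfl fun i _ => ?_
    rw [Finset.mul_sum, Finset.mul_sum]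
    exact Finset.sum_congr rfl fun k _ => sum_perm_mul_apply hrow i k
  -- For n = 1 centering makes the only entry 0, so both sides vanish whatever value 1/0 has.
  rcases eq_or_ne n 1 with rfl | hn1
  · have h0 : ∀ i j, a i j = 0 := fun i j => by
      have := hrow i
      rw [Fintype.sum_eq_single j fun x hx => absurd (Subsingleton.elim x j) hx] at this
      exact this
    simp [h0]
  rcases eq_or_ne n 0 with rfl | hn0
  · simp
  have hn0' : (n : ℝ) ≠ 0 := by exact_mod_cast hn0
  have hn1' : (n : ℝ) - 1 ≠ 0 := sub_ne_zero.2 (by exact_mod_cast hn1)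
  field_simp
  have := mul_left_cancel₀ hn0' ((mul_left_comm _ _ _).trans h1)
  linarith

end PermSums

/-! ### Moments and moment generating function of the permuted sum -/

/-- A random array of independent variables and an independent uniform random permutation. -/
structure IsPermutedArray {Ω : Type*} [MeasurableSpace Ω] {n : ℕ} (μ : Measure Ω)
    (X : Fin n → Fin n → Ω → ℝ) (π : Ω → Equiv.Perm (Fin n)) : Prop where
  measurable : ∀ i j, Measurable (X i j)
  iIndepFun : iIndepFun (fun p : Fin n × Fin n => X p.1 p.2) μ
  measurable_perm : Measurable π
  uniform : ∀ σ : Equiv.Perm (Fin n), μ.real (π ⁻¹' {σ}) = 1 / (n.factorial : ℝ)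
  indepFun : IndepFun (fun ω (p : Fin n × Fin n) => X p.1 p.2 ω) π μ

namespace IsPermutedArray

variable {Ω : Type*} [MeasurableSpace Ω] {n : ℕ} {μ : Measure Ω}
  {X : Fin n → Fin n → Ω → ℝ} {π : Ω → Equiv.Perm (Fin n)} (h : IsPermutedArray μ X π)
include h

theorem measurableSet_perm_eq (σ : Equiv.Perm (Fin n)) : MeasurableSet (π ⁻¹' {σ}) :=
  h.measurable_perm (MeasurableSpace.measurableSet_top (s := {σ}))

omit [MeasurableSpace Ω] h in
theorem comp_permSum_eq_sum {E : Type*} [AddCommMonoid E] (g : ℝ → E) (ω : Ω) :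
    g (permSum X π ω) = ∑ σ, (π ⁻¹' {σ}).indicator (fun ω => g (∑ i, X i (σ i) ω)) ω := by
  rw [Finset.sum_eq_single (π ω)]
  · simp [permSum]
  · intro σ _ hσ
    exact Set.indicator_of_notMem (fun h => hσ (by simpa using h.symm)) _
  · simp

theorem measurable_permSum : Measurable (permSum X π) := by
  have : permSum X π = fun ω => ∑ σ, (π ⁻¹' {σ}).indicator (fun ω => ∑ i, X i (σ i) ω) ω := by
    ext ω
    exact comp_permSum_eq_sum id ω
  rw [this]
  refine Finset.measurable_sum _ fun σ _ => Measurable.indicator ?_ (h.measurableSet_perm_eq σ)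
  exact Finset.measurable_sum _ fun i _ => h.measurable i (σ i)

theorem integrable_comp_permSum {E : Type*} [NormedAddCommGroup E] {g : ℝ → E}
    (hi : ∀ σ : Equiv.Perm (Fin n), Integrable (fun ω => g (∑ i, X i (σ i) ω)) μ) :
    Integrable (fun ω => g (permSum X π ω)) μ := by
  simp only [comp_permSum_eq_sum g]
  exact integrable_finsetSum _ fun σ _ => (hi σ).indicator (h.measurableSet_perm_eq σ)

theorem integral_comp_permSum {𝕜 : Type*} [RCLike 𝕜] {g : ℝ → 𝕜} (hg : Continuous g)
    (hi : ∀ σ : Equiv.Perm (Fin n), Integrable (fun ω => g (∑ i, X i (σ i) ω)) μ) :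
    ∫ ω, g (permSum X π ω) ∂μ =
      1 / (n.factorial : 𝕜) * ∑ σ : Equiv.Perm (Fin n), ∫ ω, g (∑ i, X i (σ i) ω) ∂μ := by
  simp only [comp_permSum_eq_sum g]
  rw [integral_finsetSum _ fun σ _ => (hi σ).indicator (h.measurableSet_perm_eq σ),
    Finset.mul_sum]
  refine Finset.sum_congr rfl fun σ _ => ?_
  have hX : Measurable fun ω (p : Fin n × Fin n) => X p.1 p.2 ω :=
    measurable_pi_lambda _ fun p => h.measurable p.1 p.2
  have hmf : Measurable fun x : Fin n × Fin n → ℝ => g (∑ i, x (i, σ i)) :=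
    hg.measurable.comp (Finset.measurable_sum _ fun i _ => measurable_pi_apply _)
  have hmi : Measurable (({σ} : Set (Equiv.Perm (Fin n))).indicator (fun _ => (1 : 𝕜))) :=
    measurable_const.indicator (MeasurableSpace.measurableSet_top (s := {σ}))
  have h1 := h.indepFun.integral_fun_comp_mul_comp hX.aemeasurable h.measurable_perm.aemeasurable
    hmf.aestronglyMeasurable hmi.aestronglyMeasurable
  have h2 : ∀ ω, (π ⁻¹' {σ}).indicator (fun ω => g (∑ i, X i (σ i) ω)) ω =
      g (∑ i, X i (σ i) ω) * ({σ} : Set (Equiv.Perm (Fin n))).indicator (fun _ => (1 : 𝕜)) (π ω) :=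
    fun ω => by
      by_cases hω : π ω = σ
      · simp [hω]
      · simp [hω]
  have h3 : ∫ ω, ({σ} : Set (Equiv.Perm (Fin n))).indicator (fun _ => (1 : 𝕜)) (π ω) ∂μ =
      1 / (n.factorial : 𝕜) := by
    have h4 : (fun ω => ({σ} : Set (Equiv.Perm (Fin n))).indicator (fun _ => (1 : 𝕜)) (π ω)) =
        (π ⁻¹' {σ}).indicator (fun _ => (1 : 𝕜)) := by
      ext ω
      rfl
    rw [h4, integral_indicator_const _ (h.measurableSet_perm_eq σ), h.uniform,
      RCLike.real_smul_eq_coe_mul]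
    simp
  simp only [h2]
  rw [h1, h3, mul_comm]

theorem iIndepFun_row (σ : Equiv.Perm (Fin n)) :
    ProbabilityTheory.iIndepFun (fun i => X i (σ i)) μ :=
  h.iIndepFun.precomp (g := fun i => (i, σ i)) fun _ _ hij => (Prod.ext_iff.1 hij).1

variable [IsProbabilityMeasure μ]

theorem integrable_exp_mul_sum {t : ℝ}
    (ht : ∀ i j, Integrable (fun ω => Real.exp (t * X i j ω)) μ) (σ : Equiv.Perm (Fin n)) :
    Integrable (fun ω => Real.exp (t * ∑ i, X i (σ i) ω)) μ := by
  have := (h.iIndepFun_row σ).integrable_exp_mul_sum (fun i => h.measurable i (σ i))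
    (s := Finset.univ) (t := t) fun i _ => ht i (σ i)
  simpa [Finset.sum_apply] using this

/-- Given π = σ, the summands are independent and the generating function factors along σ; averaging
over σ produces the permanent. -/
theorem complexMGF_permSum {s : ℂ}
    (ht : ∀ i j, Integrable (fun ω => Real.exp (s.re * X i j ω)) μ) :
    complexMGF (permSum X π) μ s = 1 / (n.factorial : ℂ) *
      (Matrix.of fun i j => complexMGF (X i j) μ s).permanent := by
  have hm : ∀ σ : Equiv.Perm (Fin n), Measurable fun ω => ∑ i, X i (σ i) ω := fun σ =>
    Finset.measurable_sum _ fun i _ => h.measurable i (σ i)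
  have hi : ∀ σ : Equiv.Perm (Fin n),
      Integrable (fun ω => Complex.exp (s * ((∑ i, X i (σ i) ω : ℝ) : ℂ))) μ := fun σ =>
    integrable_cexp_mul_of_re_mem_integrableExpSet (hm σ).aemeasurable
      (h.integrable_exp_mul_sum ht σ)
  rw [complexMGF, h.integral_comp_permSum (g := fun x : ℝ => Complex.exp (s * x)) (by fun_prop) hi,
    ← Matrix.permanent_transpose, Matrix.permanent]
  congr 1
  refine Finset.sum_congr rfl fun σ _ => ?_
  have h1 := (h.iIndepFun_row σ).integral_fun_prod_comp
    (f := fun _ (x : ℝ) => Complex.exp (s * x)) (fun i => (h.measurable i (σ i)).aemeasurable)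
    (fun i => (by fun_prop : Continuous fun x : ℝ => Complex.exp (s * x)).aestronglyMeasurable)
  simp only [Matrix.transpose_apply, Matrix.of_apply, complexMGF]
  rw [← h1]
  refine integral_congr_ae (ae_of_all _ fun ω => ?_)
  simp only
  rw [← Complex.exp_sum]
  push_cast
  rw [Finset.mul_sum]

theorem integral_sum_sq (hL2 : ∀ i j, MemLp (X i j) 2 μ) (σ : Equiv.Perm (Fin n)) :
    ∫ ω, (∑ i, X i (σ i) ω) ^ 2 ∂μ =
      ∑ i, variance (X i (σ i)) μ + (∑ i, ∫ ω, X i (σ i) ω ∂μ) ^ 2 := by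
  have hS : MemLp (∑ i, X i (σ i)) 2 μ := memLp_finsetSum' _ fun i _ => hL2 i (σ i)
  have h1 := IndepFun.variance_sum (s := Finset.univ) (fun i _ => hL2 i (σ i))
    fun i _ j _ hij => (h.iIndepFun_row σ).indepFun hij
  have h2 := variance_eq_sub hS
  rw [h1] at h2
  have h3 : ∫ ω, (∑ i, X i (σ i)) ω ∂μ = ∑ i, ∫ ω, X i (σ i) ω ∂μ := by
    simp only [Finset.sum_apply]
    exact integral_finsetSum _ fun i _ => (hL2 i (σ i)).integrable (by norm_num)
  rw [h3] at h2
  have h4 : ∫ ω, (∑ i, X i (σ i) ω) ^ 2 ∂μ = ∫ ω, ((∑ i, X i (σ i)) ^ 2) ω ∂μ := by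
    simp [Finset.sum_apply]
  rw [h4, h2]
  ring

theorem integral_permSum (hL2 : ∀ i j, MemLp (X i j) 2 μ)
    (hrow : ∀ i, ∑ j, ∫ ω, X i j ω ∂μ = 0) (hn : 1 ≤ n) :
    ∫ ω, permSum X π ω ∂μ = 0 := by
  have hI : ∀ i j, Integrable (X i j) μ := fun i j => (hL2 i j).integrable (by norm_num)
  have h1 := h.integral_comp_permSum (g := fun x : ℝ => x) continuous_id
    fun σ => integrable_finsetSum _ fun i _ => hI i (σ i)
  rw [h1]
  have h2 : ∀ σ : Equiv.Perm (Fin n), ∫ ω, ∑ i, X i (σ i) ω ∂μ = ∑ i, ∫ ω, X i (σ i) ω ∂μ :=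
    fun σ => integral_finsetSum _ fun i _ => hI i (σ i)
  simp only [h2]
  have h3 := sum_perm_sum_apply fun i j => ∫ ω, X i j ω ∂μ
  simp only [hrow, Finset.sum_const_zero, mul_zero] at h3
  have hn' : (n : ℝ) ≠ 0 := by exact_mod_cast (by omega : n ≠ 0)
  rw [(mul_eq_zero.1 h3).resolve_left hn', mul_zero]

theorem integral_permSum_sq (hL2 : ∀ i j, MemLp (X i j) 2 μ)
    (hcol : ∀ j, ∑ i, ∫ ω, X i j ω ∂μ = 0) (hrow : ∀ i, ∑ j, ∫ ω, X i j ω ∂μ = 0) (hn : 1 ≤ n) :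
    ∫ ω, permSum X π ω ^ 2 ∂μ = 1 / ((n : ℝ) - 1) * ∑ i, ∑ j, (∫ ω, X i j ω ∂μ) ^ 2
      + 1 / (n : ℝ) * ∑ i, ∑ j, variance (X i j) μ := by
  have h1 := h.integral_comp_permSum (g := fun x : ℝ => x ^ 2) (by fun_prop) fun σ => by
    have : MemLp (fun ω => ∑ i, X i (σ i) ω) 2 μ := memLp_finsetSum _ fun i _ => hL2 i (σ i)
    exact this.integrable_sq
  rw [h1]
  simp only [h.integral_sum_sq hL2, Finset.sum_add_distrib, mul_add]
  have h2 := sum_perm_sum_apply fun i j => variance (X i j) μ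
  have hfac : (n.factorial : ℝ) ≠ 0 := by exact_mod_cast n.factorial_ne_zero
  have hn' : (n : ℝ) ≠ 0 := by exact_mod_cast (by omega : n ≠ 0)
  have h3 := sum_perm_sq_sum_apply hcol hrow
  rw [← h3, add_comm]
  congr 1
  field_simp
  linarith

end IsPermutedArray

/-! ### Exponential moments of the entries -/

section ExpMoments

variable {Ω : Type*} [MeasurableSpace Ω] {μ : Measure Ω} {Y : Ω → ℝ} {α b : ℝ}

/-- Convexity of exp between 0 and y - log b. Integrated, this pointwise form of Lyapunov's
inequality gives both integrability and the bound b^q. -/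
theorem exp_mul_le_exp_log_mul {b q : ℝ} (hq0 : 0 ≤ q) (hq1 : q ≤ 1) (hb : 1 ≤ b) (y : ℝ) :
    Real.exp (q * y) ≤ Real.exp (q * Real.log b) * (1 - q + q * (Real.exp y / b)) := by
  have hb0 : 0 < b := by linarith
  have h1 := convexOn_exp.2 (Set.mem_univ 0) (Set.mem_univ (y - Real.log b))
    (sub_nonneg.2 hq1) hq0 (by ring)
  simp only [smul_eq_mul, mul_zero, zero_add, Real.exp_zero, mul_one] at h1
  rw [Real.exp_sub, Real.exp_log hb0] at h1
  calc Real.exp (q * y) = Real.exp (q * Real.log b) * Real.exp (q * (y - Real.log b)) := by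
        rw [← Real.exp_add]; congr 1; ring
    _ ≤ _ := by gcongr

theorem integrable_and_integral_exp_mul_abs_le [IsProbabilityMeasure μ] {q : ℝ} (hq0 : 0 ≤ q) (hq1 : q ≤ 1) (hb : 1 ≤ b)
    (hY : Measurable Y) (hi : Integrable (fun ω => Real.exp (α * |Y ω|)) μ)
    (hle : ∫ ω, Real.exp (α * |Y ω|) ∂μ ≤ b) :
    Integrable (fun ω => Real.exp (q * (α * |Y ω|))) μ ∧
      ∫ ω, Real.exp (q * (α * |Y ω|)) ∂μ ≤ Real.exp (q * Real.log b) := by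
  have hb0 : 0 < b := by linarith
  have hg : Integrable (fun ω => Real.exp (q * Real.log b) *
      (1 - q + q * (Real.exp (α * |Y ω|) / b))) μ :=
    ((integrable_const _).add ((hi.div_const b).const_mul q)).const_mul _
  have hint : Integrable (fun ω => Real.exp (q * (α * |Y ω|))) μ :=
    hg.mono' (by fun_prop) (ae_of_all _ fun ω => by
      rw [Real.norm_eq_abs, abs_of_pos (Real.exp_pos _)]
      exact exp_mul_le_exp_log_mul hq0 hq1 hb _)
  refine ⟨hint, (integral_mono hint hg fun ω => exp_mul_le_exp_log_mul hq0 hq1 hb _).trans ?_⟩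
  rw [integral_const_mul, integral_add (integrable_const _) ((hi.div_const b).const_mul q),
    integral_const_mul, integral_div]
  simp only [integral_const, probReal_univ, smul_eq_mul, one_mul]
  refine mul_le_of_le_one_right (Real.exp_pos _).le ?_
  have : (∫ ω, Real.exp (α * |Y ω|) ∂μ) / b ≤ 1 := (div_le_one hb0).2 hle
  nlinarith

theorem integrable_exp_mul_of_abs_le (hY : Measurable Y)
    (hi : Integrable (fun ω => Real.exp (α * |Y ω|)) μ) {t : ℝ} (ht : |t| ≤ α) :
    Integrable (fun ω => Real.exp (t * Y ω)) μ := by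
  refine hi.mono' (by fun_prop) (ae_of_all _ fun ω => ?_)
  rw [Real.norm_eq_abs, abs_of_pos (Real.exp_pos _), Real.exp_le_exp]
  calc t * Y ω ≤ |t * Y ω| := le_abs_self _
    _ = |t| * |Y ω| := abs_mul _ _
    _ ≤ α * |Y ω| := by gcongr

theorem mem_interior_integrableExpSet {R : ℝ}
    (hi : ∀ t : ℝ, |t| < R → Integrable (fun ω => Real.exp (t * Y ω)) μ) {t : ℝ} (ht : |t| < R) :
    t ∈ interior (integrableExpSet Y μ) := by
  refine mem_interior.2 ⟨Set.Ioo (-R) R, fun x hx => hi x (abs_lt.2 hx), isOpen_Ioo, abs_lt.1 ht⟩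

/-- The distance to 1 is at most E e^{|s||Y|} - 1 ≤ b^q - 1 with q = |s|/α, and q log b ≤ 1/20 makes
this at most 1/19. Hence the radius loses only a factor logarithmic in b. -/
theorem norm_complexMGF_sub_one_le [IsProbabilityMeasure μ] (hα : 1 ≤ α) (hb : 1 ≤ b)
    (hY : Measurable Y) (hi : Integrable (fun ω => Real.exp (α * |Y ω|)) μ)
    (hle : ∫ ω, Real.exp (α * |Y ω|) ∂μ ≤ b) {s : ℂ}
    (hs : ‖s‖ ≤ α / (20 * (1 + Real.log b))) : ‖complexMGF Y μ s - 1‖ ≤ 1 / 15 := by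
  have hlog : 0 ≤ Real.log b := Real.log_nonneg hb
  have hα0 : 0 < α := by linarith
  set q := ‖s‖ / α with hq
  have hq0 : 0 ≤ q := by positivity
  have hqL : q * (20 * (1 + Real.log b)) ≤ 1 := by
    rw [le_div_iff₀ (by positivity)] at hs
    rw [hq, div_mul_eq_mul_div, div_le_one hα0]
    exact hs
  have hq1 : q ≤ 1 := by nlinarith
  have hqα : ∀ y : ℝ, q * (α * |y|) = ‖s‖ * |y| := fun y => by
    rw [hq]
    field_simp
  obtain ⟨h1, h2⟩ := integrable_and_integral_exp_mul_abs_le hq0 hq1 hb hY hi hle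
  simp only [hqα] at h1 h2
  have hce : Integrable (fun ω => Complex.exp (s * Y ω)) μ := by
    refine h1.mono' (by fun_prop) (ae_of_all _ fun ω => ?_)
    refine (Complex.norm_exp_le_exp_norm _).trans (le_of_eq ?_)
    simp
  have h3 : complexMGF Y μ s - 1 = ∫ ω, (Complex.exp (s * Y ω) - 1) ∂μ := by
    rw [integral_sub hce (integrable_const _)]
    simp [complexMGF]
  rw [h3]
  refine (norm_integral_le_of_norm_le (h1.sub (integrable_const 1)) (ae_of_all _ fun ω => ?_)).trans
    ?_
  · have h4 := Complex.norm_exp_sub_sum_le_exp_norm_sub_sum (s * Y ω) 1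
    simpa using h4
  · simp only [Pi.sub_apply]
    rw [integral_sub h1 (integrable_const _)]
    simp only [integral_const, probReal_univ, smul_eq_mul, one_mul]
    have h5 : Real.exp (q * Real.log b) ≤ 20 / 19 := by
      have h6 : q * Real.log b ≤ 1 / 20 := by nlinarith
      have h7 := Real.add_one_le_exp (-(1 / 20 : ℝ))
      rw [Real.exp_neg] at h7
      have h8 := Real.exp_pos (1 / 20 : ℝ)
      have h9 : Real.exp (1 / 20 : ℝ) * (19 / 20) ≤ 1 := by
        calc Real.exp (1 / 20 : ℝ) * (19 / 20) ≤
            Real.exp (1 / 20 : ℝ) * (Real.exp (1 / 20 : ℝ))⁻¹ := by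
              gcongr
              linarith
          _ = 1 := mul_inv_cancel₀ h8.ne'
      have := Real.exp_le_exp.2 h6
      linarith
    linarith

end ExpMoments

/-! ### The logarithm of the moment generating function of the permuted sum -/

theorem IsPermutedArray.exists_isLogMGF {Ω : Type*} [MeasurableSpace Ω] {n : ℕ} {μ : Measure Ω}
    [IsProbabilityMeasure μ] {X : Fin n → Fin n → Ω → ℝ} {π : Ω → Equiv.Perm (Fin n)}
    (h : IsPermutedArray μ X π) (hn : 1 ≤ n) {α b R : ℝ} (hα : 1 ≤ α) (hb : 1 ≤ b)
    (hexp : ∀ i j, Integrable (fun ω => Real.exp (α * |X i j ω|)) μ ∧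
        ∫ ω, Real.exp (α * |X i j ω|) ∂μ ≤ b)
    (hcol : ∀ j, ∑ i, ∫ ω, X i j ω ∂μ = 0) (hrow : ∀ i, ∑ j, ∫ ω, X i j ω ∂μ = 0)
    (hvar : 1 / ((n : ℝ) - 1) * ∑ i, ∑ j, (∫ ω, X i j ω ∂μ) ^ 2
        + 1 / (n : ℝ) * ∑ i, ∑ j, variance (X i j) μ = 1)
    (hR : R = α / (20 * (1 + Real.log b))) :
    ∃ f, IsLogMGF μ (permSum X π) (R / 4) (768 * n / R ^ 3) f := by
  have hlog : 0 ≤ Real.log b := Real.log_nonneg hb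
  have hα0 : 0 < α := by linarith
  have hR0 : 0 < R := by rw [hR]; positivity
  have hRα : R ≤ α := by
    rw [hR, div_le_iff₀ (by positivity)]
    nlinarith
  have hiX : ∀ i j (t : ℝ), |t| < R → Integrable (fun ω => Real.exp (t * X i j ω)) μ :=
    fun i j t ht => integrable_exp_mul_of_abs_le (h.measurable i j) (hexp i j).1 (by linarith)
  have hiW : ∀ t : ℝ, |t| < R → Integrable (fun ω => Real.exp (t * permSum X π ω)) μ :=
    fun t ht => h.integrable_comp_permSum (g := fun x => Real.exp (t * x))
      fun σ => h.integrable_exp_mul_sum (fun i j => hiX i j t ht) σ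
  have hL2 : ∀ i j, MemLp (X i j) 2 μ := fun i j => by
    have := memLp_of_mem_interior_integrableExpSet
      (mem_interior_integrableExpSet (hiX i j) (t := 0) (by simpa using hR0)) 2
    exact_mod_cast this
  have hre : ∀ s ∈ Metric.ball (0 : ℂ) R, |s.re| < R := fun s hs =>
    (Complex.abs_re_le_norm s).trans_lt (by simpa using hs)
  have hint : ∀ s ∈ Metric.ball (0 : ℂ) R,
      s.re ∈ interior (integrableExpSet (permSum X π) μ) := fun s hs =>
    mem_interior_integrableExpSet hiW (hre s hs)
  have h0 : (0 : ℂ) ∈ Metric.ball (0 : ℂ) R := Metric.mem_ball_self hR0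
  have hΨ : ∀ s ∈ Metric.ball (0 : ℂ) R, complexMGF (permSum X π) μ s = 1 / (n.factorial : ℂ) *
      (Matrix.of fun i j => complexMGF (X i j) μ s).permanent := fun s hs =>
    h.complexMGF_permSum fun i j => hiX i j _ (hre s hs)
  have hnear : ∀ s ∈ Metric.ball (0 : ℂ) R,
      NearOnes (Matrix.of fun i j => complexMGF (X i j) μ s) := fun s hs i j =>
    norm_complexMGF_sub_one_le hα hb (h.measurable i j) (hexp i j).1 (hexp i j).2
      (by rw [← hR]; exact (mem_ball_zero_iff.1 hs).le)
  have hfac : (n.factorial : ℂ) ≠ 0 := by exact_mod_cast n.factorial_ne_zero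
  have hfac' : (0 : ℝ) < n.factorial := by exact_mod_cast n.factorial_pos
  -- N = n because the permanent is at most n! eⁿ; the two derivative conditions at 0 are the mean
  -- and the second moment of W.
  obtain ⟨f, hf0, hfd, hfe, hfb⟩ := exists_log_near_gaussian (Ψ := complexMGF (permSum X π) μ)
    (N := n) hR0 (by exact_mod_cast hn)
    (fun s hs => (hasDerivAt_complexMGF (hint s hs)).differentiableAt.differentiableWithinAt)
    (fun s hs => by
      rw [hΨ s hs]
      exact mul_ne_zero (one_div_ne_zero hfac) (hnear s hs).permanent_ne_zero)
    (by simp [complexMGF])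
    (by
      rw [(hasDerivAt_complexMGF (hint 0 h0)).deriv]
      simp only [zero_mul, Complex.exp_zero, mul_one]
      rw [integral_complex_ofReal, h.integral_permSum hL2 hrow hn, Complex.ofReal_zero])
    (by
      have := iteratedDeriv_complexMGF (hint 0 h0) 2
      simp only [iteratedDeriv_succ, iteratedDeriv_zero, zero_mul, Complex.exp_zero,
        mul_one] at this
      rw [this]
      simp only [← Complex.ofReal_pow]
      rw [integral_complex_ofReal, h.integral_permSum_sq hL2 hcol hrow hn, hvar,
        Complex.ofReal_one])
    (fun s hs => by
      rw [hΨ s hs, norm_mul, norm_div, norm_one, Complex.norm_natCast, one_div,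
        inv_mul_le_iff₀ hfac']
      exact (hnear s hs).norm_permanent_le)
  have hsub : Metric.ball (0 : ℂ) (R / 4) ⊆ Metric.ball 0 R :=
    Metric.ball_subset_ball (by linarith)
  exact ⟨f, fun t ht => hiW t (by linarith), hf0, hfd.mono hsub,
    fun s hs => hfe s (hsub hs), hfb⟩

/-! ### Parameters and conclusion -/

section Parameters

theorem one_add_log_pow_three_le {b : ℝ} (hb : 1 ≤ b) : (1 + Real.log b) ^ 3 ≤ 27 * b := by
  have hb0 : 0 < b := by linarith
  have hlog : 0 ≤ Real.log b := Real.log_nonneg hb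
  have h1 := Real.add_one_le_exp (Real.log b / 3)
  have h2 : Real.exp (Real.log b / 3) ^ 3 = b := by
    rw [← Real.exp_nat_mul]
    push_cast
    rw [mul_div_cancel₀ _ (by norm_num : (3 : ℝ) ≠ 0), Real.exp_log hb0]
  calc (1 + Real.log b) ^ 3 ≤ (3 * Real.exp (Real.log b / 3)) ^ 3 := by
        gcongr
        linarith
    _ = 27 * b := by rw [mul_pow, h2]; norm_num

theorem one_le_and_sq_le_zpow_add_pow {θ : ℝ} (hθ : 0 < θ) :
    1 ≤ θ ^ (-2 : ℤ) + θ ^ 6 ∧ θ ^ 2 ≤ θ ^ (-2 : ℤ) + θ ^ 6 := by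
  have h1 : 0 < θ ^ (-2 : ℤ) := by positivity
  have h2 : 0 < θ ^ 6 := by positivity
  rcases le_total 1 θ with h | h
  · have h3 : θ ^ 2 ≤ θ ^ 6 := pow_le_pow_right₀ h (by norm_num)
    have h4 : 1 ≤ θ ^ 6 := one_le_pow₀ h
    constructor <;> linarith
  · have h3 : 1 ≤ θ ^ (-2 : ℤ) := by
      rw [zpow_neg]
      exact (one_le_inv₀ (by positivity)).2 (by exact_mod_cast pow_le_one₀ hθ.le h)
    have h4 : θ ^ 2 ≤ 1 := pow_le_one₀ hθ.le h
    constructor <;> linarith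

theorem one_le_and_sq_le_rpow_add_pow_three {θ : ℝ} (hθ : 0 < θ) :
    1 ≤ θ ^ (-(1 / 2) : ℝ) + θ ∧ θ ^ 2 ≤ (θ ^ (-(1 / 2) : ℝ) + θ) ^ 3 := by
  have h1 : 0 < θ ^ (-(1 / 2) : ℝ) := by positivity
  rcases le_total 1 θ with h | h
  · refine ⟨by linarith, (pow_le_pow_right₀ h (by norm_num : 2 ≤ 3)).trans ?_⟩
    gcongr
    linarith
  · have h3 : 1 ≤ θ ^ (-(1 / 2) : ℝ) := Real.one_le_rpow_of_pos_of_le_one_of_nonpos hθ h (by norm_num)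
    have h4 : 1 ≤ θ ^ (-(1 / 2) : ℝ) + θ := by linarith
    exact ⟨h4, (pow_le_one₀ hθ.le h).trans (one_le_pow₀ h4)⟩

end Parameters

/-- The trivial bound, in the range where the tail of the normal law is bounded below. -/
theorem abs_div_one_sub_stdNormalCDF_sub_one_le {p z : ℝ} (hp0 : 0 ≤ p) (hp1 : p ≤ 1) (hz : 0 ≤ z)
    (hz1 : z ≤ 1) : |p / (1 - stdNormalCDF z) - 1| ≤ 64 := by
  have hpos := one_sub_stdNormalCDF_pos hz
  have h1 := exp_neg_sq_half_le z hz
  have h2 : (1 : ℝ) / 2 ≤ Real.exp (-z ^ 2 / 2) := by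
    have := Real.add_one_le_exp (-z ^ 2 / 2)
    nlinarith
  have h3 : 1 / 64 ≤ 1 - stdNormalCDF z := by nlinarith
  have h4 : p / (1 - stdNormalCDF z) ≤ 64 := by
    rw [div_le_iff₀ hpos]
    linarith
  have h5 : 0 ≤ p / (1 - stdNormalCDF z) := by positivity
  rw [abs_le]
  constructor <;> linarith

/-- In the range of the theorem, the radius `R` and the cubic constant `κ` of the logarithm of the
moment generating function are under control. -/
theorem radius_and_cubic_bounds {n : ℕ} (hn : 1 ≤ n) {α b z R κ : ℝ} (hα : 1 ≤ α) (hb : 1 ≤ b)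
    (hz : 0 ≤ z) (hzle : z ≤ 1 / 640 * α ^ (1 / 3 : ℝ) *
      min 1 (b⁻¹ * (thetaN n α ^ (-(1 / 2) : ℝ) + thetaN n α)⁻¹))
    (hR : R = α / (20 * (1 + Real.log b))) (hκ : κ = 768 * n / R ^ 3) :
    0 < R ∧ 0 ≤ κ ∧ 0 ≤ deltaN n α b ∧ κ ≤ 2 ^ 28 * deltaN n α b ∧
      1 / (R / 4) ≤ 80 * deltaN n α b ∧ z ≤ R / 4 / 4 ∧ κ * z ^ 3 ≤ 1 := by
  have hα0 : 0 < α := by linarith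
  have hb0 : 0 < b := by linarith
  have hn0 : (0 : ℝ) < n := by exact_mod_cast hn
  set L := 1 + Real.log b with hL
  have hL1 : 1 ≤ L := by linarith [Real.log_nonneg hb]
  have hLb : L ≤ b := by linarith [Real.log_le_sub_one_of_pos hb0]
  have hL3 : L ^ 3 ≤ 27 * b := one_add_log_pow_three_le hb
  set θ := thetaN n α with hθ
  have hθ0 : 0 < θ := by
    rw [hθ, thetaN]
    positivity
  have hθ2 : θ ^ 2 * α ^ 2 = n := by
    rw [hθ, thetaN, ← Real.sqrt_eq_rpow, mul_pow, Real.sq_sqrt hn0.le]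
    field_simp
  obtain ⟨hQ1, hQ2⟩ := one_le_and_sq_le_zpow_add_pow hθ0
  obtain ⟨hP1, hP2⟩ := one_le_and_sq_le_rpow_add_pow_three hθ0
  have hδ : b ^ 2 * α⁻¹ * (θ ^ (-2 : ℤ) + θ ^ 6) ≤ deltaN n α b := by
    rw [deltaN, ← hθ]
    have : 0 ≤ (n : ℝ) ^ (-(1 / 2) : ℝ) := by positivity
    gcongr
    linarith
  set Q := θ ^ (-2 : ℤ) + θ ^ 6 with hQ
  set P := θ ^ (-(1 / 2) : ℝ) + θ with hP
  clear_value P Q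
  have hP0 : 0 < P := by linarith
  have hR0 : 0 < R := by rw [hR]; positivity
  have hκ0 : 0 ≤ κ := by rw [hκ]; positivity
  -- Uses n = θ²α² and 768 · 20³ = 6144000; after L³ ≤ 27b the constant 27 · 6144000 is below 2²⁸.
  have hκeq : κ = 6144000 * (θ ^ 2 * L ^ 3 * α⁻¹) := by
    rw [hκ, hR, ← hθ2]
    field_simp
    norm_num
  have hbb : b ≤ b ^ 2 := by nlinarith
  have hκδ : κ ≤ 2 ^ 28 * deltaN n α b := by
    have h1 : θ ^ 2 * L ^ 3 * α⁻¹ ≤ Q * (27 * b ^ 2) * α⁻¹ := by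
      gcongr
      linarith
    have h2 : Q * (27 * b ^ 2) * α⁻¹ = 27 * (b ^ 2 * α⁻¹ * Q) := by ring
    have h3 : 0 ≤ b ^ 2 * α⁻¹ * Q := by positivity
    linarith
  have hRδ : 1 / (R / 4) ≤ 80 * deltaN n α b := by
    have h1 : 1 / (R / 4) = 80 * (L * α⁻¹) := by
      rw [hR]
      field_simp
      norm_num
    have h2 : L * α⁻¹ ≤ b ^ 2 * α⁻¹ * Q := by
      calc L * α⁻¹ = L * α⁻¹ * 1 := by ring
        _ ≤ b ^ 2 * α⁻¹ * Q := by
          gcongr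
          linarith
    linarith
  have hzle' : z ≤ 1 / 640 * α ^ (1 / 3 : ℝ) * (b⁻¹ * P⁻¹) :=
    hzle.trans (by gcongr; exact min_le_right _ _)
  have hzR : z ≤ R / 4 / 4 := by
    have h1 : α ^ (1 / 3 : ℝ) ≤ α := Real.rpow_le_self_of_one_le hα (by norm_num)
    have h2 : P⁻¹ ≤ 1 := inv_le_one_of_one_le₀ hP1
    have h3 : b⁻¹ ≤ L⁻¹ := by gcongr
    calc z ≤ 1 / 640 * α ^ (1 / 3 : ℝ) * (b⁻¹ * P⁻¹) := hzle'
      _ ≤ 1 / 640 * α * (L⁻¹ * 1) := by gcongr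
      _ ≤ 1 / 320 * α * L⁻¹ := by
        have : 0 < α * L⁻¹ := by positivity
        linarith
      _ = R / 4 / 4 := by
        rw [hR]
        field_simp
        norm_num
  have hκz : κ * z ^ 3 ≤ 1 := by
    have h1 : (α ^ (1 / 3 : ℝ)) ^ 3 = α := by
      rw [← Real.rpow_natCast, ← Real.rpow_mul hα0.le]
      norm_num
    have h2 : z ^ 3 ≤ (1 / 640) ^ 3 * α * (b⁻¹ * P⁻¹) ^ 3 := by
      calc z ^ 3 ≤ (1 / 640 * α ^ (1 / 3 : ℝ) * (b⁻¹ * P⁻¹)) ^ 3 := by gcongr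
        _ = _ := by rw [mul_pow, mul_pow, h1]
    -- The cube root of α in the range of z cancels the α⁻¹ in κ, and P³ absorbs θ². The constant
    -- 1/640 is small enough because 27 · 6144000 < 640³.
    calc κ * z ^ 3 ≤ κ * ((1 / 640) ^ 3 * α * (b⁻¹ * P⁻¹) ^ 3) := by gcongr
      _ = 6144000 * (1 / 640) ^ 3 * (θ ^ 2 * L ^ 3 * (b⁻¹ * P⁻¹) ^ 3) := by
        rw [hκeq]
        field_simp
      _ ≤ 6144000 * (1 / 640) ^ 3 * (P ^ 3 * (27 * b ^ 3) * (b⁻¹ * P⁻¹) ^ 3) := by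
        have : b ≤ b ^ 3 := by nlinarith
        gcongr
        linarith
      _ = 6144000 * (1 / 640) ^ 3 * 27 := by
        field_simp
      _ ≤ 1 := by norm_num
  exact ⟨hR0, hκ0, le_trans (by positivity) hδ, hκδ, hRδ, hzR, hκz⟩

theorem theorem3p1 :
    ∃ C c : ℝ, 0 < C ∧ 0 < c ∧
      ∀ (n : ℕ), 1 ≤ n →
      ∀ (Ω : Type*) [MeasurableSpace Ω] (μ : Measure Ω) [IsProbabilityMeasure μ]
        (X : Fin n → Fin n → Ω → ℝ) (π : Ω → Equiv.Perm (Fin n)) (α b : ℝ),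
      -- an array of independent random variables
      (∀ i j, Measurable (X i j)) →
      iIndepFun (fun p : Fin n × Fin n => X p.1 p.2) μ →
      -- a uniform random permutation, independent of the array
      Measurable π →
      (∀ σ : Equiv.Perm (Fin n), μ.real (π ⁻¹' {σ}) = 1 / (n.factorial : ℝ)) →
      IndepFun (fun ω (p : Fin n × Fin n) => X p.1 p.2 ω) π μ →
      -- exponential moments
      1 ≤ α → 1 ≤ b →
      (∀ i j, Integrable (fun ω => Real.exp (α * |X i j ω|)) μ ∧
        ∫ ω, Real.exp (α * |X i j ω|) ∂μ ≤ b) →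
      -- centered columns and rows of means
      (∀ j, ∑ i, ∫ ω, X i j ω ∂μ = 0) →
      (∀ i, ∑ j, ∫ ω, X i j ω ∂μ = 0) →
      -- normalization
      1 / ((n : ℝ) - 1) * ∑ i, ∑ j, (∫ ω, X i j ω ∂μ) ^ 2
        + 1 / (n : ℝ) * ∑ i, ∑ j, variance (X i j) μ = 1 →
      ∀ z : ℝ, 0 ≤ z →
        z ≤ c * α ^ (1 / 3 : ℝ) *
          min 1 (b⁻¹ * (thetaN n α ^ (-(1 / 2) : ℝ) + thetaN n α)⁻¹) →
        |μ.real {ω | z < permSum X π ω} / (1 - stdNormalCDF z) - 1|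
          ≤ C * deltaN n α b * (1 + z ^ 3) := by
  obtain ⟨C, hC, hmod⟩ := exists_moderate_deviation_of_isLogMGF
  refine ⟨C * (2 ^ 28 + 80) + 64 * 2 ^ 28, 1 / 640, by positivity, by norm_num, ?_⟩
  intro n hn Ω _ μ _ X π α b hX hind hπ hunif hXπ hα hb hexp hcol hrow hvar z hz hzle
  have h : IsPermutedArray μ X π := ⟨hX, hind, hπ, hunif, hXπ⟩
  obtain ⟨hR0, hκ0, hδ0, hκδ, hRδ, hzR, hκz⟩ :=
    radius_and_cubic_bounds hn hα hb hz hzle rfl rfl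
  obtain ⟨f, hf⟩ := h.exists_isLogMGF hn hα hb hexp hcol hrow hvar rfl
  set R := α / (20 * (1 + Real.log b)) with hR
  set κ := 768 * n / R ^ 3 with hκ
  clear_value κ R
  have hz3 : 0 ≤ z ^ 3 := by positivity
  rcases le_or_gt κ 1 with hκ1 | hκ1
  · refine (hmod Ω μ (permSum X π) (R / 4) κ z f h.measurable_permSum hf (by positivity) hκ0 hκ1 hz
      hzR hκz).trans ?_
    gcongr ?_ * _
    calc C * (κ + 1 / (R / 4)) ≤ C * (2 ^ 28 * deltaN n α b + 80 * deltaN n α b) := by gcongr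
      _ = C * (2 ^ 28 + 80) * deltaN n α b := by ring
      _ ≤ _ := by
        gcongr
        linarith
  -- If κ > 1, then κz³ ≤ 1 forces z ≤ 1, while 1 < κ ≤ 2²⁸ δ; the trivial bound 64 then suffices
  -- and accounts for the summand 64 · 2²⁸ in the constant.
  · have hz1 : z ≤ 1 := by
      by_contra hz1
      have h1 : 1 ≤ z ^ 3 := one_le_pow₀ (not_le.1 hz1).le
      linarith [le_mul_of_one_le_right hκ0 h1]
    refine (abs_div_one_sub_stdNormalCDF_sub_one_le measureReal_nonneg measureReal_le_one hz
      hz1).trans ?_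
    have h1 : 1 ≤ 2 ^ 28 * deltaN n α b := by linarith
    have h2 : 0 ≤ C * (2 ^ 28 + 80) * deltaN n α b := by positivity
    have h3 : 64 ≤ (C * (2 ^ 28 + 80) + 64 * 2 ^ 28) * deltaN n α b := by
      rw [add_mul, mul_assoc 64]
      linarith
    exact h3.trans (le_mul_of_one_le_right (by linarith) (by linarith))
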